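/- Let $k$ be a field, $A$ an associative unital $k$-algebra, $B\subseteq A$ a $k$-subalgebra, $\pi:A\to A/B$ the canonical projection of $B$-bimodules, and $X$ an $A$-bimodule ($k$ acting centrally). Write $A^e=A\otimes_k A^{op}$, $B^e=B\otimes_k B^{op}$; a bimodule is regarded as a left or as a right module over the enveloping algebra. A left $A^e$-module is relatively projective if it has the lifting property for all $A^e$-linear maps that admit a $B^e$-linear section. A relative projective resolution $P_*\to A$ is a complex of relatively projective $A^e$-modules with an augmentation to $A$ such that the augmented complex has a $B^e$-linear contracting homotopy. The relative Hochschild homology is $$H_*(A|B,X)=\mathsf{Tor}_*^{A^e|B^e}(X,A)=H_*(X\otimes_{A^e}P_*)$$ for such a resolution $P_*\to A$. Put $(A/B)^{\otimes_B 0}=B$ and $C_n(A|B,X)=X\otimes_{B^e}(A/B)^{\otimes_B n}$ for $n\ge 0$; thus $C_0(A|B,X)=X\otimes_{B^e}B$, whose elements $x\otimes 1$ are written $x$. Then relative projective resolutions of $A$ exist, the map $x\mapsto x\otimes 1$ induces an isomorphism $X_B=X/\langle bx-xb : b\in B, x\in X\rangle\cong X\otimes_{B^e}B$, and the following hold. 1.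 For every $k$-linear section $\sigma$ of $\pi$ there are unique $k$-linear maps $b_{A|B}:C_n(A|B,X)\to C_{n-1}(A|B,X)$, $n\ge 1$, such that for all $x\in X$ and $\alpha_1,\dots,\alpha_n\in A/B$ $$\begin{aligned} b_{A|B}(x\otimes\alpha_1\otimes\dots\otimes\alpha_n)={}& x\sigma(\alpha_1)\otimes\alpha_2\otimes\dots\otimes\alpha_n\\ &+\sum_{i=1}^{n-1}(-1)^i\,x\otimes\alpha_1\otimes\dots\otimes\pi(\sigma(\alpha_i)\sigma(\alpha_{i+1}))\otimes\dots\otimes\alpha_n\\ &+(-1)^n\,\sigma(\alpha_n)x\otimes\alpha_1\otimes\dots\otimes\alpha_{n-1}.\end{aligned}$$ 2. The maps $b_{A|B}$ do not depend on the choice of $\sigma$. 3. $b_{A|B}\circ b_{A|B}=0$, and for every relative projective resolution $P_*\to A$ and every $n\ge 0$ the homology of the complex $(C_*(A|B,X),b_{A|B})$ in degree $n$ is isomorphic, as a $k$-vector space, to $H_n(X\otimes_{A^e}P_*)=H_n(A|B,X)$. -/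

import Mathlib

open CategoryTheory TensorProduct MulOpposite

universe u

noncomputable section

namespace RelHoch

/-! ### Tensor products over a noncommutative algebra -/

section Balanced

variable (k R : Type u) [Field k] [Ring R] [Algebra k R]

/-- The `k`-span of all `x r ⊗ y - x ⊗ r y` in `M ⊗[k] N`, for a right `R`-module `M`
and a left `R`-module `N`. -/
def balancedRel (M N : Type u) [AddCommGroup M] [Module k M] [Module Rᵐᵒᵖ M]
    [AddCommGroup N] [Module k N] [Module R N] : Submodule k (M ⊗[k] N) :=
  Submodule.span k {z | ∃ (x : M) (r : R) (y : N), z = (op r • x) ⊗ₜ[k] y - x ⊗ₜ[k] (r • y)}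

attribute [local instance] ModuleCat.moduleOfAlgebraModule
  ModuleCat.isScalarTower_of_algebra_moduleCat

/-- The tensor product `M ⊗_R N` of a right `R`-module and a left `R`-module over a
(possibly noncommutative) `k`-algebra `R`, as a `k`-vector space. -/
def tensorOver (M : ModuleCat.{u} Rᵐᵒᵖ) (N : ModuleCat.{u} R) : ModuleCat.{u} k :=
  ModuleCat.of k ((M ⊗[k] N) ⧸ balancedRel k R M N)

variable {R}

/-- The pure tensor `x ⊗ y` in `M ⊗_R N`. -/
def tmulOver {M : ModuleCat.{u} Rᵐᵒᵖ} {N : ModuleCat.{u} R} (x : M) (y : N) :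
    tensorOver k R M N :=
  Submodule.Quotient.mk (p := balancedRel k R M N) (x ⊗ₜ[k] y)

theorem tmulOver_smul {M : ModuleCat.{u} Rᵐᵒᵖ} {N : ModuleCat.{u} R} (x : M) (r : R) (y : N) :
    tmulOver k (op r • x) y = tmulOver k x (r • y) :=
  (Submodule.Quotient.eq _).2 (Submodule.subset_span ⟨x, r, y, rfl⟩)

/-- The map `f ⊗ g : M ⊗_R N → M' ⊗_R N'`. -/
def mapOver {M M' : ModuleCat.{u} Rᵐᵒᵖ} {N N' : ModuleCat.{u} R}
    (f : M →ₗ[Rᵐᵒᵖ] M') (g : N →ₗ[R] N') :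
    tensorOver k R M N →ₗ[k] tensorOver k R M' N' :=
  Submodule.mapQ (balancedRel k R M N) (balancedRel k R M' N')
    (TensorProduct.map (f.restrictScalars k) (g.restrictScalars k)) (by
      refine Submodule.span_le.2 ?_
      rintro _ ⟨x, r, y, rfl⟩
      refine Submodule.subset_span ⟨f x, r, g y, ?_⟩
      simp [map_sub])

@[simp]
theorem mapOver_tmulOver {M M' : ModuleCat.{u} Rᵐᵒᵖ} {N N' : ModuleCat.{u} R}
    (f : M →ₗ[Rᵐᵒᵖ] M') (g : N →ₗ[R] N') (x : M) (y : N) :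
    mapOver k f g (tmulOver k x y) = tmulOver k (f x) (g y) := rfl

theorem tensorOver_hom_ext {M : ModuleCat.{u} Rᵐᵒᵖ} {N : ModuleCat.{u} R} {Z : ModuleCat.{u} k}
    {f g : tensorOver k R M N →ₗ[k] Z}
    (h : ∀ x y, f (tmulOver k x y) = g (tmulOver k x y)) : f = g := by
  apply Submodule.linearMap_qext
  apply TensorProduct.ext'
  exact h

theorem tmulOver_add {M : ModuleCat.{u} Rᵐᵒᵖ} {N : ModuleCat.{u} R} (x : M) (y y' : N) :
    tmulOver k x (y + y') = tmulOver k x y + tmulOver k x y' := by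
  simp only [tmulOver, TensorProduct.tmul_add]; rfl

theorem add_tmulOver {M : ModuleCat.{u} Rᵐᵒᵖ} {N : ModuleCat.{u} R} (x x' : M) (y : N) :
    tmulOver k (x + x') y = tmulOver k x y + tmulOver k x' y := by
  simp only [tmulOver, TensorProduct.add_tmul]; rfl

theorem zero_tmulOver {M : ModuleCat.{u} Rᵐᵒᵖ} {N : ModuleCat.{u} R} (y : N) :
    tmulOver k (0 : M) y = 0 := by
  simp only [tmulOver, TensorProduct.zero_tmul]; rfl

theorem tmulOver_zero {M : ModuleCat.{u} Rᵐᵒᵖ} {N : ModuleCat.{u} R} (x : M) :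
    tmulOver k x (0 : N) = 0 := by
  simp only [tmulOver, TensorProduct.tmul_zero]; rfl

theorem algebraMap_smul_tmulOver {M : ModuleCat.{u} Rᵐᵒᵖ} {N : ModuleCat.{u} R} (c : k)
    (x : M) (y : N) : tmulOver k (algebraMap k Rᵐᵒᵖ c • x) y = c • tmulOver k x y := by
  simp only [tmulOver, algebraMap_smul, ← TensorProduct.smul_tmul']; rfl

theorem tmulOver_algebraMap_smul {M : ModuleCat.{u} Rᵐᵒᵖ} {N : ModuleCat.{u} R} (c : k)
    (x : M) (y : N) : tmulOver k x (algebraMap k R c • y) = c • tmulOver k x y := by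
  simp only [tmulOver, algebraMap_smul, TensorProduct.tmul_smul]; rfl

variable (R) in
/-- The functor `M ⊗_R -` from left `R`-modules to `k`-vector spaces. -/
def tensorFunctor (M : ModuleCat.{u} Rᵐᵒᵖ) : ModuleCat.{u} R ⥤ ModuleCat.{u} k where
  obj N := tensorOver k R M N
  map g := ModuleCat.ofHom (mapOver k LinearMap.id g.hom)
  map_id N := by
    ext1
    exact tensorOver_hom_ext k fun x y => rfl
  map_comp f g := by
    ext1
    exact tensorOver_hom_ext k fun x y => rfl

instance (M : ModuleCat.{u} Rᵐᵒᵖ) : (tensorFunctor k R M).Additive where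
  map_add {N N' f g} := by
    ext1
    exact tensorOver_hom_ext k fun x y => tmulOver_add k x (f.hom y) (g.hom y)

end Balanced

/-! ### Relative homological algebra for a `k`-algebra map `φ : S → R` -/

section Relative

variable {k S R : Type u} [Field k] [Ring S] [Algebra k S] [Ring R] [Algebra k R]

/-- `P` is relatively projective: every `R`-linear map from `P` lifts through every `R`-linear
map that has an `S`-linear section. -/
def IsRelProjective (φ : S →ₐ[k] R) (P : ModuleCat.{u} R) : Prop :=
  ∀ ⦃M N : ModuleCat.{u} R⦄ (g : M ⟶ N),
    IsSplitEpi ((ModuleCat.restrictScalars φ.toRingHom).map g) →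
      ∀ f : P ⟶ N, ∃ h : P ⟶ M, h ≫ g = f

/-- A relative projective resolution `⋯ → P₁ → P₀ → Y → 0` of the left `R`-module `Y`: a complex
of relatively projective `R`-modules with an `R`-linear augmentation such that the augmented
complex has an `S`-linear contracting homotopy. -/
structure RelProjResolution (φ : S →ₐ[k] R) (Y : ModuleCat.{u} R) where
  /-- the complex of `R`-modules -/
  complex : ChainComplex (ModuleCat.{u} R) ℕ
  /-- the augmentation -/
  aug : complex.X 0 ⟶ Y
  d_aug : complex.d 1 0 ≫ aug = 0
  relProjective : ∀ n, IsRelProjective φ (complex.X n)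
  contractible :
    ∃ (s₀ : (ModuleCat.restrictScalars φ.toRingHom).obj Y ⟶
          (ModuleCat.restrictScalars φ.toRingHom).obj (complex.X 0))
      (s : ∀ n, (ModuleCat.restrictScalars φ.toRingHom).obj (complex.X n) ⟶
          (ModuleCat.restrictScalars φ.toRingHom).obj (complex.X (n + 1))),
      s₀ ≫ (ModuleCat.restrictScalars φ.toRingHom).map aug = 𝟙 _ ∧
      (ModuleCat.restrictScalars φ.toRingHom).map aug ≫ s₀ +
        s 0 ≫ (ModuleCat.restrictScalars φ.toRingHom).map (complex.d 1 0) = 𝟙 _ ∧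
      ∀ n, (ModuleCat.restrictScalars φ.toRingHom).map (complex.d (n + 1) n) ≫ s n +
        s (n + 1) ≫ (ModuleCat.restrictScalars φ.toRingHom).map (complex.d (n + 2) (n + 1)) = 𝟙 _

/-- The relative `Tor_n^{R|S}(M, Y)`, computed with the relative projective resolution `P` of `Y`:
the homology of `M ⊗_R P`. -/
def relTor {φ : S →ₐ[k] R} {Y : ModuleCat.{u} R} (M : ModuleCat.{u} Rᵐᵒᵖ)
    (P : RelProjResolution φ Y) (n : ℕ) : ModuleCat.{u} k :=
  (((tensorFunctor k R M).mapHomologicalComplex (ComplexShape.down ℕ)).obj P.complex).homology n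

end Relative

/-! ### Bimodules, as left modules over the enveloping algebra -/

section Bimodules

variable (k : Type u) [Field k]

/-- The enveloping algebra `A^e = A ⊗ A^op`; a left `A^e`-module is an `A`-bimodule with
`a x a' = (a ⊗ op a') • x`. -/
abbrev Env (A : Type u) [Ring A] [Algebra k A] : Type u := A ⊗[k] Aᵐᵒᵖ

variable {k} {A : Type u} [Ring A] [Algebra k A]

/-- Left multiplication `a x` on an `A`-bimodule. -/
def lact {X : ModuleCat.{u} (Env k A)} (a : A) (x : X) : X := (a ⊗ₜ[k] (1 : Aᵐᵒᵖ) : Env k A) • x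

/-- Right multiplication `x a` on an `A`-bimodule. -/
def ract {X : ModuleCat.{u} (Env k A)} (x : X) (a : A) : X := ((1 : A) ⊗ₜ[k] op a : Env k A) • x

/-- The underlying left `A`-module of an `A`-bimodule. -/
def toLeft (X : ModuleCat.{u} (Env k A)) : ModuleCat.{u} A :=
  (ModuleCat.restrictScalars
    (Algebra.TensorProduct.includeLeft : A →ₐ[k] Env k A).toRingHom).obj X

/-- The underlying right `A`-module of an `A`-bimodule. -/
def toRight (X : ModuleCat.{u} (Env k A)) : ModuleCat.{u} Aᵐᵒᵖ :=
  (ModuleCat.restrictScalars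
    (Algebra.TensorProduct.includeRight : Aᵐᵒᵖ →ₐ[k] Env k A).toRingHom).obj X

variable (k A) in
/-- The isomorphism from the opposite of `A^e` to `A^e`, exchanging the two tensor factors. -/
def envSwap : (Env k A)ᵐᵒᵖ ≃ₐ[k] Env k A :=
  (Algebra.TensorProduct.opAlgEquiv k k A Aᵐᵒᵖ).symm.trans
    ((Algebra.TensorProduct.congr (AlgEquiv.refl (R := k) (A₁ := Aᵐᵒᵖ))
      (AlgEquiv.opOp k A).symm).trans (Algebra.TensorProduct.comm k Aᵐᵒᵖ A))

theorem envSwap_tmul (a a' : A) :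
    envSwap k A (op (a ⊗ₜ[k] op a')) = a' ⊗ₜ[k] op a := rfl

/-- An `A`-bimodule as a right `A^e`-module: `x (a ⊗ op a') = a' x a`. -/
def toRightEnv (X : ModuleCat.{u} (Env k A)) : ModuleCat.{u} (Env k A)ᵐᵒᵖ :=
  (ModuleCat.restrictScalars (envSwap k A).toAlgHom.toRingHom).obj X

variable (k A) in
/-- `A` as a bimodule over itself. -/
def selfBimod : ModuleCat.{u} (Env k A) :=
  letI : Module (Env k A) A := TensorProduct.Algebra.module
  ModuleCat.of (Env k A) A

theorem selfBimod_smul (a a' : A) (x : A) :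
    ((a ⊗ₜ[k] op a' : Env k A) • (show selfBimod k A from x) : selfBimod k A) =
      (a * x * a' : A) := by
  let : Module (Env k A) A := TensorProduct.Algebra.module
  change (a ⊗ₜ[k] op a' : Env k A) • x = a * x * a'
  rw [TensorProduct.Algebra.smul_def]
  simp [mul_assoc]

section Tensor

variable (M N : ModuleCat.{u} (Env k A))

/-- Left multiplication by `a` on a bimodule, as a map of right modules. -/
def lactHom (a : A) : toRight M →ₗ[Aᵐᵒᵖ] toRight M where
  toFun x := lact (X := M) a x
  map_add' x y := smul_add (M := A ⊗[k] Aᵐᵒᵖ) (A := M) _ x y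
  map_smul' c x := by
    change (_ : Env k A) • (_ : Env k A) • (show M from x) =
      (_ : Env k A) • (_ : Env k A) • (show M from x)
    rw [smul_smul, smul_smul]
    congr 1
    simp

/-- Right multiplication by `a` on a bimodule, as a map of left modules. -/
def ractHom (a : Aᵐᵒᵖ) : toLeft N →ₗ[A] toLeft N where
  toFun y := ract (X := N) y a.unop
  map_add' x y := smul_add (M := A ⊗[k] Aᵐᵒᵖ) (A := N) _ x y
  map_smul' c x := by
    change (_ : Env k A) • (_ : Env k A) • (show N from x) =
      (_ : Env k A) • (_ : Env k A) • (show N from x)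
    rw [smul_smul, smul_smul]
    congr 1
    simp

attribute [local instance] ModuleCat.moduleOfAlgebraModule
  ModuleCat.isScalarTower_of_algebra_moduleCat

/-- The pure tensor of elements of two bimodules `M` and `N`, in the vector space `M ⊗_A N`. -/
def tmulUnd (x : M) (y : N) : tensorOver k A (toRight M) (toLeft N) :=
  tmulOver k (M := toRight M) (N := toLeft N) x y

/-- The left action of `A` on `M ⊗_A N`. -/
def tensorLeftAct : A →ₐ[k] Module.End k (tensorOver k A (toRight M) (toLeft N)) where
  toFun a := mapOver k (lactHom M a) LinearMap.id
  map_one' := tensorOver_hom_ext k fun (x : M) (y : N) => by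
    change tmulUnd M N ((1 : Env k A) • (x : M)) y = _
    rw [one_smul]; rfl
  map_mul' a b := tensorOver_hom_ext k fun (x : M) (y : N) => by
    change tmulUnd M N (((a * b) ⊗ₜ[k] (1 : Aᵐᵒᵖ) : Env k A) • (x : M)) y =
      tmulUnd M N ((a ⊗ₜ[k] (1 : Aᵐᵒᵖ) : Env k A) • (b ⊗ₜ[k] (1 : Aᵐᵒᵖ) : Env k A) •
        (x : M)) y
    rw [smul_smul, Algebra.TensorProduct.tmul_mul_tmul, one_mul]
  map_zero' := tensorOver_hom_ext k fun (x : M) (y : N) => by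
    change tmulUnd M N (((0 : A) ⊗ₜ[k] (1 : Aᵐᵒᵖ) : Env k A) • (x : M)) y = 0
    rw [TensorProduct.zero_tmul]
    refine (congrArg (fun z : M => tmulUnd M N z y) (zero_smul (Env k A) x)).trans ?_
    exact zero_tmulOver k (M := toRight M) (N := toLeft N) y
  map_add' a b := tensorOver_hom_ext k fun (x : M) (y : N) => by
    change tmulUnd M N (((a + b) ⊗ₜ[k] (1 : Aᵐᵒᵖ) : Env k A) • (x : M)) y = _
    rw [TensorProduct.add_tmul, add_smul]
    exact add_tmulOver k (M := toRight M) (N := toLeft N) _ _ y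
  commutes' c := tensorOver_hom_ext k fun (x : M) (y : N) => by
    have h : ((algebraMap k A c) ⊗ₜ[k] (1 : Aᵐᵒᵖ) : Env k A) =
        (1 : A) ⊗ₜ[k] (algebraMap k Aᵐᵒᵖ c) := by
      rw [Algebra.algebraMap_eq_smul_one, Algebra.algebraMap_eq_smul_one,
        TensorProduct.smul_tmul]
    change tmulUnd M N (((algebraMap k A c) ⊗ₜ[k] (1 : Aᵐᵒᵖ) : Env k A) • (x : M)) y = _
    rw [h]
    exact algebraMap_smul_tmulOver k (M := toRight M) (N := toLeft N) c x y

/-- The right action of `A` on `M ⊗_A N`. -/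
def tensorRightAct : Aᵐᵒᵖ →ₐ[k] Module.End k (tensorOver k A (toRight M) (toLeft N)) where
  toFun a := mapOver k LinearMap.id (ractHom N a)
  map_one' := tensorOver_hom_ext k fun (x : M) (y : N) => by
    change tmulUnd M N x ((1 : Env k A) • (y : N)) = _
    rw [one_smul]; rfl
  map_mul' a b := tensorOver_hom_ext k fun (x : M) (y : N) => by
    change tmulUnd M N x (((1 : A) ⊗ₜ[k] (a * b) : Env k A) • (y : N)) =
      tmulUnd M N x (((1 : A) ⊗ₜ[k] a : Env k A) • ((1 : A) ⊗ₜ[k] b : Env k A) •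
        (y : N))
    rw [smul_smul, Algebra.TensorProduct.tmul_mul_tmul, one_mul]
  map_zero' := tensorOver_hom_ext k fun (x : M) (y : N) => by
    change tmulUnd M N x (((1 : A) ⊗ₜ[k] (0 : Aᵐᵒᵖ) : Env k A) • (y : N)) = 0
    rw [TensorProduct.tmul_zero]
    refine (congrArg (fun z : N => tmulUnd M N x z) (zero_smul (Env k A) y)).trans ?_
    exact tmulOver_zero k (M := toRight M) (N := toLeft N) x
  map_add' a b := tensorOver_hom_ext k fun (x : M) (y : N) => by
    change tmulUnd M N x (((1 : A) ⊗ₜ[k] (a + b) : Env k A) • (y : N)) = _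
    rw [TensorProduct.tmul_add, add_smul]
    exact tmulOver_add k (M := toRight M) (N := toLeft N) x _ _
  commutes' c := tensorOver_hom_ext k fun (x : M) (y : N) => by
    have h : ((1 : A) ⊗ₜ[k] (algebraMap k Aᵐᵒᵖ c) : Env k A) =
        (algebraMap k A c) ⊗ₜ[k] (1 : Aᵐᵒᵖ) := by
      rw [Algebra.algebraMap_eq_smul_one, Algebra.algebraMap_eq_smul_one,
        TensorProduct.smul_tmul]
    change tmulUnd M N x (((1 : A) ⊗ₜ[k] (algebraMap k Aᵐᵒᵖ c) : Env k A) • (y : N)) = _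
    rw [h]
    exact tmulOver_algebraMap_smul k (M := toRight M) (N := toLeft N) c x y

theorem tensorAct_commute (a : A) (a' : Aᵐᵒᵖ) :
    Commute (tensorLeftAct M N a) (tensorRightAct M N a') :=
  tensorOver_hom_ext k fun _ _ => rfl

/-- The `A`-bimodule `M ⊗_A N`, with `a (x ⊗ y) a' = a x ⊗ y a'`. -/
def bimodTensor : ModuleCat.{u} (Env k A) :=
  letI : Module (Env k A) (tensorOver k A (toRight M) (toLeft N)) :=
    Module.compHom _ (Algebra.TensorProduct.lift (tensorLeftAct M N) (tensorRightAct M N)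
      (tensorAct_commute M N)).toRingHom
  ModuleCat.of (Env k A) (tensorOver k A (toRight M) (toLeft N))

variable {M N}

/-- The pure tensor `x ⊗ y` in the bimodule `M ⊗_A N`. -/
def bimodTmul (x : M) (y : N) : bimodTensor M N :=
  tmulUnd M N x y

theorem bimodTmul_balanced (x : M) (a : A) (y : N) :
    bimodTmul (ract x a) y = bimodTmul x (lact a y) :=
  tmulOver_smul k (M := toRight M) (N := toLeft N) x a y

theorem smul_bimodTmul (a a' : A) (x : M) (y : N) :
    (a ⊗ₜ[k] op a' : Env k A) • bimodTmul x y = bimodTmul (lact a x) (ract y a') := by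
  change (Algebra.TensorProduct.lift (tensorLeftAct M N) (tensorRightAct M N)
    (tensorAct_commute M N) (a ⊗ₜ[k] op a')) (tmulUnd M N x y) = _
  rw [Algebra.TensorProduct.lift_tmul]
  rfl

end Tensor

/-- The tensor power `M^{⊗_A n}` of an `A`-bimodule, with `M^{⊗_A 0} = A` and
`M^{⊗_A (n + 1)} = M ⊗_A M^{⊗_A n}`. -/
def bimodPow (M : ModuleCat.{u} (Env k A)) : ℕ → ModuleCat.{u} (Env k A)
  | 0 => selfBimod k A
  | n + 1 => bimodTensor M (bimodPow M n)

/-- The pure tensor `α₁ ⊗ ⋯ ⊗ αₙ` in `M^{⊗_A n}`; it is `1 ∈ A` for `n = 0`. -/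
def bimodPowMk {M : ModuleCat.{u} (Env k A)} : (n : ℕ) → (Fin n → M) → bimodPow M n
  | 0, _ => (1 : A)
  | n + 1, α => bimodTmul (α 0) (bimodPowMk n (Fin.tail α))

end Bimodules

/-! ### The complex of an extension `B ⊆ A` -/

section Extension

variable {k : Type u} [Field k] {A : Type u} [Ring A] [Algebra k A] (B : Subalgebra k A)

/-- The algebra map `B^e → A^e`. -/
def envMap : Env k B →ₐ[k] Env k A :=
  Algebra.TensorProduct.map B.val (AlgHom.op B.val)

/-- Restriction of an `A`-bimodule to a `B`-bimodule. -/
def resBimod (X : ModuleCat.{u} (Env k A)) : ModuleCat.{u} (Env k B) :=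
  (ModuleCat.restrictScalars (envMap B).toRingHom).obj X

theorem resBimod_smul (X : ModuleCat.{u} (Env k A)) (b b' : B) (x : X) :
    ((b ⊗ₜ[k] op b' : Env k B) • (show resBimod B X from x) : resBimod B X) =
      (((b : A) ⊗ₜ[k] op (b' : A) : Env k A) • x : X) := rfl

/-- `B` as a `B`-subbimodule of `A`. -/
def subBimod : Submodule (Env k B) (resBimod B (selfBimod k A)) where
  carrier := {a | id (α := A) a ∈ B}
  add_mem' := fun ha hb => B.add_mem ha hb
  zero_mem' := B.zero_mem
  smul_mem' := by
    intro c a (ha : _ ∈ B)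
    change id (α := A) (c • a) ∈ B
    induction c using TensorProduct.induction_on with
    | zero =>
      exact (congrArg (fun z : A => z ∈ B)
        (zero_smul (Env k B) (show resBimod B (selfBimod k A) from a))).mpr B.zero_mem
    | tmul b b' =>
      have h := (resBimod_smul B (selfBimod k A) b b'.unop a).trans
        (selfBimod_smul (b : A) (b'.unop : A) a)
      exact (congrArg (fun z : A => z ∈ B) h).mpr
        (B.mul_mem (B.mul_mem b.2 ha) b'.unop.2)
    | add x y hx hy =>
      exact (congrArg (fun z : A => z ∈ B)
        (add_smul x y (show resBimod B (selfBimod k A) from a))).mpr (B.add_mem hx hy)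

/-- The `B`-bimodule `A/B`. -/
def quotBimod : ModuleCat.{u} (Env k B) :=
  ModuleCat.of (Env k B) (resBimod B (selfBimod k A) ⧸ subBimod B)

/-- The canonical projection `π : A → A/B`. -/
def proj (a : A) : quotBimod B :=
  Submodule.Quotient.mk (p := subBimod B) (show resBimod B (selfBimod k A) from a)

theorem proj_eq_zero_iff (a : A) : proj B a = 0 ↔ a ∈ B :=
  Submodule.Quotient.mk_eq_zero (subBimod B)

theorem smul_proj (b b' : B) (a : A) :
    (b ⊗ₜ[k] op b' : Env k B) • proj B a = proj B (b * a * b') := by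
  exact congrArg (proj B) (selfBimod_smul (b : A) (b' : A) a)

attribute [local instance] ModuleCat.moduleOfAlgebraModule
  ModuleCat.isScalarTower_of_algebra_moduleCat

/-- A `k`-linear section `σ` of `π : A → A/B`. -/
structure LinearSection where
  /-- the underlying `k`-linear map -/
  toMap : quotBimod B →ₗ[k] A
  proj_toMap : ∀ α, proj B (toMap α) = α

variable (X : ModuleCat.{u} (Env k A))

/-- The `k`-vector space `X ⊗_{B^e} (A/B)^{⊗_B n}`. -/
def relChain (n : ℕ) : ModuleCat.{u} k :=
  tensorOver k (Env k B) (toRightEnv (resBimod B X)) (bimodPow (quotBimod B) n)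

variable {X} in
/-- The pure tensor `x ⊗ α₁ ⊗ ⋯ ⊗ αₙ` in `X ⊗_{B^e} (A/B)^{⊗_B n}`. -/
def relChainMk {n : ℕ} (x : X) (α : Fin n → quotBimod B) : relChain B X n :=
  tmulOver k (M := toRightEnv (resBimod B X)) x (bimodPowMk n α)

/-- The family `b` of linear maps is given on pure tensors by the formula
`b(x ⊗ α₁ ⊗ ⋯ ⊗ αₙ) = x σ(α₁) ⊗ α₂ ⊗ ⋯ ⊗ αₙ
  + ∑_{i=1}^{n-1} (-1)^i x ⊗ α₁ ⊗ ⋯ ⊗ π(σ(αᵢ) σ(αᵢ₊₁)) ⊗ ⋯ ⊗ αₙ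
  + (-1)^n σ(αₙ) x ⊗ α₁ ⊗ ⋯ ⊗ αₙ₋₁`; here `n + 1` is written for `n`, and indices start at `0`. -/
def IsRelBoundary (σ : LinearSection B) (b : ∀ n, relChain B X (n + 1) ⟶ relChain B X n) : Prop :=
  ∀ (n : ℕ) (x : X) (α : Fin (n + 1) → quotBimod B),
    b n (relChainMk B x α) =
      relChainMk B (ract x (σ.toMap (α 0))) (Fin.tail α) +
      ∑ i : Fin n, (-1 : ℤ) ^ ((i : ℕ) + 1) •
        relChainMk B x
          (Fin.contractNth i.castSucc (fun β γ => proj B (σ.toMap β * σ.toMap γ)) α) +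
      (-1 : ℤ) ^ (n + 1) •
        relChainMk B (lact (σ.toMap (α (Fin.last n))) x) (Fin.init α)

/-- `X_B = X / ⟨b x - x b⟩ = H_0(B, X)`. -/
def coinvariants : ModuleCat.{u} k :=
  ModuleCat.of k (X ⧸ Submodule.span k
    {z : X | ∃ (b : B) (x : X), z = lact (b : A) x - ract x (b : A)})

variable {X} in
/-- The class of `x` in `X_B`. -/
def coinvariantsMk (x : X) : coinvariants B X := Submodule.Quotient.mk x

/-- The relative Hochschild homology `H_n(A|B, X) = Tor_n^{A^e|B^e}(X, A)`, computed with the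
relative projective resolution `P` of the `A^e`-module `A`. -/
def relHH (P : RelProjResolution (envMap B) (selfBimod k A)) (n : ℕ) : ModuleCat.{u} k :=
  relTor (toRightEnv X) P n

end Extension

end RelHoch

end

/-! The obstacle is that neither `x σ(α₁) ⊗ α₂ ⊗ ⋯` nor the contraction terms are balanced over `B`
or independent of `σ`; only their alternating sum is. The device is a twisted coefficient bimodule.
The space `X ⊗_B A/B` carries an `A`-bimodule structure (`twist`) with left action on `X` and right
action `(x ⊗ π(c)) a = x ⊗ π(ca) - xc ⊗ π(a)`. For `a ∈ B` the correction term vanishes, so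
associativity gives `C_{n+1}(A|B, X) ≅ C_n(A|B, X ⊗_B A/B)`, the first tensor factor being absorbed
into the coefficients. Under this identification the boundary in degree `n + 2` for `X` is minus the
boundary in degree `n + 1` for the twist: the two terms of the twisted right action are the first
contraction and the leading term of the formula.

The boundary is therefore defined by recursion on the degree, for all coefficients at once
(`relBoundary`), starting from the commutator map `x ⊗ π(a) ↦ xa - ax` from `(X ⊗_B A/B)_B` to `X_B
≅ X ⊗_{B^e} B`. Well-definedness needs checking only for the twisted action and for the commutator.
The recursion yields the formula for every `σ` (`isRelBoundary_relBoundary`), and since pure tensors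
span, uniqueness and independence of `σ` follow (`isRelBoundary_iff`). The square is zero because
the two signs cancel in the induction (`relBoundary_relBoundary`).

For the homology, take `X = A^e` with the bimodule structure from right multiplication. Left
multiplications are bimodule endomorphisms, so by naturality in `X` the complex `C_*(A|B, A^e)`
consists of `A^e`-modules. These are induced from `B^e`, hence relatively projective. The map `A^e →
twist A^e`, `a ⊗ a' ↦ (1 ⊗ a') ⊗ π(a)`, is left `A`-linear but fails to be right `A`-linear by
exactly `x ⊗ π(c)` (`barShift_ract_sub`). Only the leading term of the boundary sees this defect
(`relChainMap_relBoundary_sub`), which makes the map a contracting homotopy. Thus `C_*(A|B, A^e)` is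
a relative projective resolution, and `X ⊗_{A^e} C_*(A|B, A^e) ≅ C_*(A|B, X)`, again by naturality.
The comparison theorem for relative resolutions transfers the homology to any other resolution. -/

noncomputable section

namespace RelHoch

attribute [local instance] ModuleCat.moduleOfAlgebraModule
  ModuleCat.isScalarTower_of_algebra_moduleCat

/-! ### Universal property of the tensor product over a noncommutative algebra. -/

section Lift

variable {k R : Type u} [Field k] [Ring R] [Algebra k R]

/-- The linear map out of `M ⊗_R N` given by a balanced biadditive map. -/
def liftOver {M : ModuleCat.{u} Rᵐᵒᵖ} {N : ModuleCat.{u} R} {Z : Type u} [AddCommGroup Z]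
    [Module k Z] (f : M →+ N →+ Z)
    (hk : ∀ (c : k) (x : M) (y : N), f x (algebraMap k R c • y) = c • f x y)
    (hb : ∀ (x : M) (r : R) (y : N), f (op r • x) y = f x (r • y)) :
    tensorOver k R M N →ₗ[k] Z :=
  Submodule.liftQ (balancedRel k R M N)
    (TensorProduct.lift (LinearMap.mk₂ k (fun x y => f x y)
      (fun x x' y => by simp) (fun c x y => by
        rw [← algebraMap_smul Rᵐᵒᵖ c x, ← hk]
        exact hb x (algebraMap k R c) y)
      (fun x y y' => by simp) (fun c x y => by
        rw [← algebraMap_smul R c y, hk]))) (by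
      refine Submodule.span_le.2 ?_
      rintro _ ⟨x, r, y, rfl⟩
      simp [hb])

theorem tensorOver_induction {M : ModuleCat.{u} Rᵐᵒᵖ} {N : ModuleCat.{u} R}
    {p : tensorOver k R M N → Prop} (zero : p 0) (tmul : ∀ x y, p (tmulOver k x y))
    (add : ∀ z w, p z → p w → p (z + w)) (z : tensorOver k R M N) : p z := by
  obtain ⟨z, rfl⟩ := Submodule.Quotient.mk_surjective _ z
  induction z using TensorProduct.induction_on with
  | zero => exact zero
  | tmul x y => exact tmul x y
  | add x y hx hy => exact add _ _ hx hy

/-- A biadditive map as a homomorphism of additive groups. -/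
def biaddHom {X Y Z : Type*} [AddCommGroup X] [AddCommGroup Y] [AddCommGroup Z] (f : X → Y → Z)
    (hr : ∀ x y y', f x (y + y') = f x y + f x y')
    (hl : ∀ x x' y, f (x + x') y = f x y + f x' y) : X →+ Y →+ Z :=
  AddMonoidHom.mk' (fun x => AddMonoidHom.mk' (f x) (hr x)) fun x x' => by ext y; exact hl x x' y

@[simp]
theorem biaddHom_apply {X Y Z : Type*} [AddCommGroup X] [AddCommGroup Y] [AddCommGroup Z]
    (f : X → Y → Z) (hr : ∀ x y y', f x (y + y') = f x y + f x y')
    (hl : ∀ x x' y, f (x + x') y = f x y + f x' y) (x : X) (y : Y) :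
    biaddHom f hr hl x y = f x y := rfl

/-- Pure tensors as a biadditive map. -/
def tmulHom (M : ModuleCat.{u} Rᵐᵒᵖ) (N : ModuleCat.{u} R) : M →+ N →+ tensorOver k R M N :=
  AddMonoidHom.mk' (fun x => AddMonoidHom.mk' (fun y => tmulOver k x y) (tmulOver_add k x))
    (fun x x' => by ext y; exact add_tmulOver k x x' y)

end Lift

/-! ### Calculus of left and right actions on bimodules. -/

section Bimodule

variable {k : Type u} [Field k] {A : Type u} [Ring A] [Algebra k A]

section

variable {X Y : ModuleCat.{u} (Env k A)}

theorem env_smul_eq (a : A) (a' : Aᵐᵒᵖ) (x : X) :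
    (a ⊗ₜ[k] a' : Env k A) • x = lact a (ract x a'.unop) := by
  rw [lact, ract, smul_smul, Algebra.TensorProduct.tmul_mul_tmul, mul_one, one_mul, op_unop]

theorem lact_add (a : A) (x y : X) : lact a (x + y) = lact a x + lact a y := smul_add _ _ _

theorem add_ract (x y : X) (a : A) : ract (x + y) a = ract x a + ract y a := smul_add _ _ _

@[simp]
theorem lact_zero (a : A) : lact a (0 : X) = 0 := smul_zero _

@[simp]
theorem zero_ract (a : A) : ract (0 : X) a = 0 := smul_zero _

theorem add_lact (a b : A) (x : X) : lact (a + b) x = lact a x + lact b x := by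
  rw [lact, TensorProduct.add_tmul, add_smul]; rfl

theorem ract_add (x : X) (a b : A) : ract x (a + b) = ract x a + ract x b := by
  rw [ract, MulOpposite.op_add, TensorProduct.tmul_add, add_smul]; rfl

theorem lact_lact (a b : A) (x : X) : lact a (lact b x) = lact (a * b) x := by
  simp [lact, smul_smul]

theorem ract_ract (x : X) (a b : A) : ract (ract x a) b = ract x (a * b) := by
  simp [ract, smul_smul]

theorem lact_ract (a : A) (x : X) (b : A) : lact a (ract x b) = ract (lact a x) b := by
  simp [lact, ract, smul_smul]

@[simp]
theorem one_lact (x : X) : lact (1 : A) x = x := one_smul (Env k A) x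

@[simp]
theorem ract_one (x : X) : ract x (1 : A) = x := one_smul (Env k A) x

theorem algebraMap_env (c : k) :
    algebraMap k (Env k A) c = (algebraMap k A c) ⊗ₜ[k] (1 : Aᵐᵒᵖ) := rfl

/-- Scalars cross the tensor sign of `A ⊗[k] Aᵐᵒᵖ`; this is why `k` acts centrally on every
bimodule. -/
theorem algebraMap_tmul_one (c : k) :
    (algebraMap k A c) ⊗ₜ[k] (1 : Aᵐᵒᵖ) = (1 : A) ⊗ₜ[k] op (algebraMap k A c) := by
  rw [← MulOpposite.algebraMap_apply, Algebra.algebraMap_eq_smul_one,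
    Algebra.algebraMap_eq_smul_one, TensorProduct.smul_tmul]

theorem algebraMap_lact (c : k) (x : X) : lact (algebraMap k A c) x = c • x := rfl

theorem ract_algebraMap (c : k) (x : X) : ract x (algebraMap k A c) = c • x := by
  rw [ract, ← algebraMap_tmul_one]; rfl

theorem hom_lact (f : X ⟶ Y) (a : A) (x : X) : f (lact a x) = lact a (f x) :=
  map_smul f.hom _ _

theorem hom_ract (f : X ⟶ Y) (x : X) (a : A) : f (ract x a) = ract (f x) a :=
  map_smul f.hom _ _

theorem smul_ract (c : k) (x : X) (a : A) : ract (c • x) a = c • ract x a := by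
  rw [← algebraMap_lact, ← algebraMap_lact, lact_ract]

theorem ract_smul (x : X) (c : k) (a : A) : ract x (c • a) = c • ract x a := by
  rw [Algebra.smul_def, ← ract_ract, ract_algebraMap, smul_ract]

theorem smul_lact (c : k) (a : A) (x : X) : lact (c • a) x = c • lact a x := by
  rw [Algebra.smul_def, ← lact_lact, algebraMap_lact]

theorem sub_lact (a b : A) (x : X) : lact (a - b) x = lact a x - lact b x := by
  rw [eq_sub_iff_add_eq, ← add_lact, sub_add_cancel]

/-- An additive map of bimodules that commutes with the left and right actions. -/
def bimodHom (f : X →+ Y) (hl : ∀ a x, f (lact a x) = lact a (f x))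
    (hr : ∀ a x, f (ract x a) = ract (f x) a) : X ⟶ Y :=
  ModuleCat.ofHom
    { f with
      map_smul' := fun c x => by
        change f (c • x) = c • f x
        induction c using TensorProduct.induction_on with
        | zero =>
          exact (congrArg f (zero_smul (Env k A) x)).trans
            ((map_zero f).trans (zero_smul (Env k A) (f x)).symm)
        | tmul a a' => rw [env_smul_eq, env_smul_eq, hl, hr]
        | add c d hc hd => rw [add_smul, add_smul, map_add, hc, hd] }

end

/-- The bimodule given by commuting left and right actions on a vector space. -/
def bimodOf (Z : Type u) [AddCommGroup Z] [Module k Z] (l : A →ₐ[k] Module.End k Z)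
    (r : Aᵐᵒᵖ →ₐ[k] Module.End k Z) (h : ∀ a a', Commute (l a) (r a')) :
    ModuleCat.{u} (Env k A) :=
  letI : Module (Env k A) Z :=
    Module.compHom _ (Algebra.TensorProduct.lift l r h).toRingHom
  ModuleCat.of (Env k A) Z

section

variable (Z : Type u) [AddCommGroup Z] [Module k Z] (l : A →ₐ[k] Module.End k Z)
    (r : Aᵐᵒᵖ →ₐ[k] Module.End k Z) (h : ∀ a a', Commute (l a) (r a'))

theorem bimodOf_lact (a : A) (z : Z) :
    lact (X := bimodOf Z l r h) a z = l a z := by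
  change (Algebra.TensorProduct.lift l r h (a ⊗ₜ[k] (1 : Aᵐᵒᵖ))) z = _
  rw [Algebra.TensorProduct.lift_tmul, map_one, mul_one]

theorem bimodOf_ract (a : A) (z : Z) :
    ract (X := bimodOf Z l r h) z a = r (op a) z := by
  change (Algebra.TensorProduct.lift l r h ((1 : A) ⊗ₜ[k] op a)) z = _
  rw [Algebra.TensorProduct.lift_tmul, map_one, one_mul]

end

section Pow

variable {M N : ModuleCat.{u} (Env k A)}

theorem lact_bimodTmul (a : A) (x : M) (y : N) :
    lact a (bimodTmul x y) = bimodTmul (lact a x) y :=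
  (smul_bimodTmul a 1 x y).trans (by rw [ract_one])

theorem ract_bimodTmul (x : M) (y : N) (a : A) :
    ract (bimodTmul x y) a = bimodTmul x (ract y a) :=
  (smul_bimodTmul 1 a x y).trans (by rw [one_lact])

theorem bimodTmul_add (x : M) (y y' : N) :
    bimodTmul x (y + y') = bimodTmul x y + bimodTmul x y' :=
  tmulOver_add k (M := toRight M) (N := toLeft N) x y y'

theorem add_bimodTmul (x x' : M) (y : N) :
    bimodTmul (x + x') y = bimodTmul x y + bimodTmul x' y :=
  add_tmulOver k (M := toRight M) (N := toLeft N) x x' y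

theorem bimodTensor_induction {p : bimodTensor M N → Prop} (zero : p 0)
    (tmul : ∀ x y, p (bimodTmul x y)) (add : ∀ z w, p z → p w → p (z + w))
    (z : bimodTensor M N) : p z :=
  tensorOver_induction (M := toRight M) (N := toLeft N) zero tmul add z

theorem bimodTensor_addHom_ext {Z : Type*} [AddCommGroup Z] {f g : bimodTensor M N →+ Z}
    (h : ∀ x y, f (bimodTmul x y) = g (bimodTmul x y)) : f = g := by
  ext z
  induction z using bimodTensor_induction with
  | zero => simp
  | tmul x y => exact h x y
  | add z w hz hw => rw [map_add, map_add, hz, hw]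

/-- The additive map out of `M ⊗_A N` given by a balanced biadditive map. -/
def bimodLift {Z : Type u} [AddCommGroup Z] [Module k Z] (f : M →+ N →+ Z)
    (hk : ∀ (c : k) (x : M) (y : N), f x (c • y) = c • f x y)
    (hb : ∀ (x : M) (a : A) (y : N), f (ract x a) y = f x (lact a y)) :
    bimodTensor M N →+ Z :=
  (liftOver (M := toRight M) (N := toLeft N) f hk hb).toAddMonoidHom

/-- An element of `A` as an element of the bimodule `A`. -/
def selfMk (a : A) : selfBimod k A := a

theorem selfMk_surjective (x : selfBimod k A) : ∃ a, selfMk a = x := ⟨x, rfl⟩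

theorem lact_selfMk (a x : A) : lact a (selfMk x : selfBimod k A) = selfMk (a * x) :=
  (selfBimod_smul a 1 x).trans (mul_one (a * x))

theorem ract_selfMk (x a : A) : ract (selfMk x : selfBimod k A) a = selfMk (x * a) :=
  (selfBimod_smul 1 a x).trans (congrArg (· * a) (one_mul x))

theorem smul_selfMk (c : k) (x : A) : c • (selfMk x : selfBimod k A) = selfMk (c • x) := by
  rw [← algebraMap_lact, lact_selfMk, Algebra.smul_def]

end Pow

end Bimodule

/-! ### The quotient `A/B` and its linear sections. -/

section Quotient

variable {k : Type u} [Field k] {A : Type u} [Ring A] [Algebra k A] (B : Subalgebra k A)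

theorem proj_surjective (α : quotBimod B) : ∃ a, proj B a = α :=
  Submodule.Quotient.mk_surjective _ α

theorem proj_add (a a' : A) : proj B (a + a') = proj B a + proj B a' := rfl

theorem proj_sub (a a' : A) : proj B (a - a') = proj B a - proj B a' := rfl

theorem proj_zero : proj B 0 = 0 := rfl

theorem lact_proj (b : B) (a : A) : lact b (proj B a) = proj B (b * a) :=
  (smul_proj B b 1 a).trans (by simp)

theorem proj_ract (a : A) (b : B) : ract (proj B a) b = proj B (a * b) :=
  (smul_proj B 1 b a).trans (by simp)

theorem proj_smul (c : k) (a : A) : proj B (c • a) = c • proj B a := by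
  rw [← algebraMap_lact, lact_proj, Algebra.smul_def]; rfl

theorem exists_linearSection : Nonempty (LinearSection B) := by
  let p : A →ₗ[k] quotBimod B :=
    { toFun := proj B
      map_add' := proj_add B
      map_smul' := proj_smul B }
  obtain ⟨g, hg⟩ := p.exists_rightInverse_of_surjective
    (LinearMap.range_eq_top.2 (proj_surjective B))
  exact ⟨⟨g, fun α => LinearMap.congr_fun hg α⟩⟩

/-- A chosen section of `A → A/B`. -/
def someSection : LinearSection B := Classical.choice (exists_linearSection B)

variable {B}

/-- The source of independence of `σ`: a representative and its image under `σ ∘ π` differ by an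
element of `B`. -/
theorem LinearSection.exists_eq_add (σ : LinearSection B) (a : A) :
    ∃ b : B, a = σ.toMap (proj B a) + b := by
  refine ⟨⟨a - σ.toMap (proj B a), ?_⟩, by simp⟩
  rw [← proj_eq_zero_iff, proj_sub, σ.proj_toMap, sub_self]

theorem proj_coe (b : B) : proj B (b : A) = 0 := (proj_eq_zero_iff B _).2 b.2

end Quotient

/-! ### The twisted bimodule `X ⊗_B A/B`. -/

section Twist

variable {k : Type u} [Field k] {A : Type u} [Ring A] [Algebra k A] (B : Subalgebra k A)
variable (X : ModuleCat.{u} (Env k A))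

/-- The vector space `X ⊗_B A/B`. -/
abbrev twistSpace : ModuleCat.{u} k :=
  tensorOver k B (toRight (resBimod B X)) (toLeft (quotBimod B))

variable {X}

/-- Pure tensors in `X ⊗_B A/B`. -/
def twistTmul (x : X) (v : quotBimod B) : twistSpace B X :=
  tmulOver k (M := toRight (resBimod B X)) (N := toLeft (quotBimod B)) x v

theorem twistTmul_add (x : X) (v w : quotBimod B) :
    twistTmul B x (v + w) = twistTmul B x v + twistTmul B x w :=
  tmulOver_add k (M := toRight (resBimod B X)) (N := toLeft (quotBimod B)) x v w

theorem add_twistTmul (x y : X) (v : quotBimod B) :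
    twistTmul B (x + y) v = twistTmul B x v + twistTmul B y v :=
  add_tmulOver k (M := toRight (resBimod B X)) (N := toLeft (quotBimod B)) x y v

@[simp]
theorem twistTmul_zero (x : X) : twistTmul B x 0 = 0 :=
  tmulOver_zero k (M := toRight (resBimod B X)) (N := toLeft (quotBimod B)) x

theorem ract_twistTmul (x : X) (b : B) (v : quotBimod B) :
    twistTmul B (ract x (b : A)) v = twistTmul B x (lact b v) :=
  tmulOver_smul k (M := toRight (resBimod B X)) (N := toLeft (quotBimod B)) x b v

theorem twistTmul_smul (c : k) (x : X) (v : quotBimod B) :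
    twistTmul B x (c • v) = c • twistTmul B x v :=
  tmulOver_algebraMap_smul k (M := toRight (resBimod B X)) (N := toLeft (quotBimod B)) c x v

theorem smul_twistTmul (c : k) (x : X) (v : quotBimod B) :
    twistTmul B (c • x) v = c • twistTmul B x v := by
  rw [← ract_algebraMap, ← twistTmul_smul]
  exact ract_twistTmul B x (algebraMap k B c) v

theorem twistSpace_induction {p : twistSpace B X → Prop} (zero : p 0)
    (tmul : ∀ x a, p (twistTmul B x (proj B a))) (add : ∀ z w, p z → p w → p (z + w))
    (z : twistSpace B X) : p z :=
  tensorOver_induction zero (fun x v => by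
    obtain ⟨a, rfl⟩ := proj_surjective B v
    exact tmul x a) add z

/-- The linear map out of `X ⊗_B A/B` given by a balanced biadditive map on `X × A` that
vanishes on `X × B`. -/
def twistLift {Z : Type u} [AddCommGroup Z] [Module k Z] (f : X →+ A →+ Z)
    (hk : ∀ (c : k) (x : X) (a : A), f x (c • a) = c • f x a)
    (hb : ∀ (x : X) (b : B) (a : A), f (ract x (b : A)) a = f x (b * a))
    (h0 : ∀ (x : X) (b : B), f x b = 0) : twistSpace B X →ₗ[k] Z :=
  -- Vanishing on `B` makes `f x` depend only on the class in `A/B`, so the section chosen to define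
  -- `g` affects neither the values nor the balancing.
  have key (v w : A) (h : proj B v = proj B w) (x : X) : f x v = f x w := by
    rw [← sub_eq_zero, ← map_sub]
    exact h0 x ⟨v - w, (proj_eq_zero_iff B _).1 (by rw [proj_sub, h, sub_self])⟩
  let g : X →+ quotBimod B →+ Z :=
    AddMonoidHom.mk' (fun x => (f x).comp (someSection B).toMap.toAddMonoidHom)
      (fun x y => by rw [map_add]; rfl)
  liftOver (M := toRight (resBimod B X)) (N := toLeft (quotBimod B))
    g
    (fun c (x : X) (y : quotBimod B) =>
      (congrArg (f x) ((someSection B).toMap.map_smul c y)).trans (hk c x _))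
    (fun (x : X) (b : B) (v : quotBimod B) =>
      (hb x b ((someSection B).toMap v)).trans (key _ ((someSection B).toMap (lact b v)) (by
        rw [← lact_proj, (someSection B).proj_toMap, (someSection B).proj_toMap]) x))

theorem twistLift_twistTmul {Z : Type u} [AddCommGroup Z] [Module k Z] (f : X →+ A →+ Z)
    (hk : ∀ (c : k) (x : X) (a : A), f x (c • a) = c • f x a)
    (hb : ∀ (x : X) (b : B) (a : A), f (ract x (b : A)) a = f x (b * a))
    (h0 : ∀ (x : X) (b : B), f x b = 0) (x : X) (a : A) :
    twistLift B f hk hb h0 (twistTmul B x (proj B a)) = f x a := by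
  change f x ((someSection B).toMap (proj B a)) = f x a
  obtain ⟨b, h⟩ := (someSection B).exists_eq_add a
  conv_rhs => rw [h, map_add, h0, add_zero]

theorem twist_hom_ext {Z : Type*} [AddCommGroup Z] [Module k Z] {f g : twistSpace B X →ₗ[k] Z}
    (h : ∀ x a, f (twistTmul B x (proj B a)) = g (twistTmul B x (proj B a))) : f = g := by
  ext z
  induction z using twistSpace_induction with
  | zero => simp
  | tmul x a => exact h x a
  | add z w hz hw => rw [map_add, map_add, hz, hw]

/-- The biadditive map `(x, c) ↦ x ⊗ π(c a) - x c ⊗ π(a)`. -/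
def twistRightFun (a : A) : X →+ A →+ twistSpace B X :=
  AddMonoidHom.mk' (fun x => AddMonoidHom.mk'
      (fun c => twistTmul B x (proj B (c * a)) - twistTmul B (ract x c) (proj B a))
      (fun c d => by
        rw [add_mul, proj_add, twistTmul_add, ract_add, add_twistTmul]; abel))
    (fun x y => by
      ext c
      change twistTmul B _ _ - twistTmul B _ _ = twistTmul B _ _ - twistTmul B _ _ +
        (twistTmul B _ _ - twistTmul B _ _)
      rw [add_ract, add_twistTmul, add_twistTmul]; abel)

theorem twistRightFun_apply (a : A) (x : X) (c : A) : twistRightFun B a x c =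
    twistTmul B x (proj B (c * a)) - twistTmul B (ract x c) (proj B a) := rfl

/-- The right action of `a` on `X ⊗_B A/B`: `(x ⊗ π(c)) a = x ⊗ π(c a) - x c ⊗ π(a)`. -/
def twistRight (a : A) : twistSpace B X →ₗ[k] twistSpace B X :=
  twistLift B (twistRightFun B a)
    (fun c x a' => by
      rw [twistRightFun_apply, twistRightFun_apply, smul_mul_assoc, proj_smul, twistTmul_smul,
        ract_smul, smul_twistTmul, smul_sub])
    (fun x b c => by
      rw [twistRightFun_apply, twistRightFun_apply, ract_twistTmul, lact_proj, ract_ract,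
        mul_assoc])
    -- The correction term is forced here: for `c = b ∈ B` the terms `x ⊗ π(ba)` and `xb ⊗ π(a)`
    -- cancel across `⊗_B`, while `x ⊗ π(ca)` alone need not vanish.
    (fun x b => by
      rw [twistRightFun_apply, ract_twistTmul, lact_proj, sub_self])

theorem twistRight_twistTmul (a : A) (x : X) (c : A) :
    twistRight B a (twistTmul B x (proj B c)) =
      twistTmul B x (proj B (c * a)) - twistTmul B (ract x c) (proj B a) :=
  twistLift_twistTmul B _ _ _ _ x c

/-- The left action of `a` on `X ⊗_B A/B`: `a (x ⊗ v) = a x ⊗ v`. -/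
def twistLeft (a : A) : twistSpace B X →ₗ[k] twistSpace B X :=
  twistLift B
    (AddMonoidHom.mk' (fun x => AddMonoidHom.mk' (fun c => twistTmul B (lact a x) (proj B c))
      (fun c d => by rw [proj_add, twistTmul_add]))
      (fun x y => by
        ext c
        change twistTmul B _ _ = twistTmul B _ _ + twistTmul B _ _
        rw [lact_add, add_twistTmul]))
    (fun c x a' => by
      change twistTmul B _ _ = c • twistTmul B _ _
      rw [proj_smul, twistTmul_smul])
    (fun x b c => by
      change twistTmul B _ _ = twistTmul B _ _
      rw [lact_ract, ract_twistTmul, lact_proj])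
    (fun x b => by
      change twistTmul B _ _ = 0
      rw [proj_coe, twistTmul_zero])

theorem twistLeft_twistTmul (a : A) (x : X) (v : quotBimod B) :
    twistLeft B a (twistTmul B x v) = twistTmul B (lact a x) v := by
  obtain ⟨c, rfl⟩ := proj_surjective B v
  exact twistLift_twistTmul B _ _ _ _ x c

variable (X)

/-- The left action of `A` on `X ⊗_B A/B`. -/
def twistLeftAct : A →ₐ[k] Module.End k (twistSpace B X) where
  toFun a := twistLeft B a
  map_one' := twist_hom_ext B fun x a => by simp [twistLeft_twistTmul]
  map_mul' a b := twist_hom_ext B fun x c => by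
    simp [twistLeft_twistTmul, lact_lact]
  map_zero' := twist_hom_ext B fun x c => by
    rw [twistLeft_twistTmul, ← sub_self (0 : A), sub_lact, sub_self]
    simpa using smul_twistTmul B (0 : k) (0 : X) (proj B c)
  map_add' a b := twist_hom_ext B fun x c => by
    simp [twistLeft_twistTmul, add_lact, add_twistTmul]
  commutes' c := twist_hom_ext B fun x a => by
    simp [twistLeft_twistTmul, algebraMap_lact, smul_twistTmul, Module.algebraMap_end_apply]

/-- The right action of `A` on `X ⊗_B A/B`. -/
def twistRightAct : Aᵐᵒᵖ →ₐ[k] Module.End k (twistSpace B X) where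
  toFun a := twistRight B a.unop
  map_one' := twist_hom_ext B fun x a => by
    have : proj B (1 : A) = 0 := proj_coe (1 : B)
    simp [twistRight_twistTmul, this]
  -- Acting by `b` and then by `a` produces `xcb ⊗ π(a)` twice, with opposite signs; what remains is
  -- the action of the product.
  map_mul' a b := twist_hom_ext B fun x c => by
    simp only [unop_mul, twistRight_twistTmul, Module.End.mul_apply, map_sub, ract_ract, mul_assoc]
    abel
  map_zero' := twist_hom_ext B fun x c => by
    simp [twistRight_twistTmul, proj_zero]
  map_add' a b := twist_hom_ext B fun x c => by
    simp only [MulOpposite.unop_add, twistRight_twistTmul, LinearMap.add_apply, mul_add, proj_add,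
      twistTmul_add]
    abel
  commutes' c := twist_hom_ext B fun x a => by
    have : proj B (algebraMap k A c) = 0 := proj_coe (algebraMap k B c)
    simp only [MulOpposite.algebraMap_apply, unop_op, twistRight_twistTmul, this, twistTmul_zero,
      sub_zero, Module.algebraMap_end_apply, ← twistTmul_smul, ← proj_smul, Algebra.smul_def,
      Algebra.commutes]

theorem twistAct_commute (a : A) (a' : Aᵐᵒᵖ) :
    Commute (twistLeftAct B X a) (twistRightAct B X a') :=
  twist_hom_ext B fun x c => by
    change twistLeft B a (twistRight B a'.unop (twistTmul B x (proj B c))) =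
      twistRight B a'.unop (twistLeft B a (twistTmul B x (proj B c)))
    rw [twistRight_twistTmul, map_sub, twistLeft_twistTmul, twistLeft_twistTmul,
      twistLeft_twistTmul, twistRight_twistTmul, lact_ract]

/-- The `A`-bimodule `X ⊗_B A/B` with the left action of `A` on `X` and the right action
`(x ⊗ π(c)) a = x ⊗ π(c a) - x c ⊗ π(a)`. -/
def twist : ModuleCat.{u} (Env k A) :=
  bimodOf (twistSpace B X) (twistLeftAct B X) (twistRightAct B X) (twistAct_commute B X)

variable {X}

/-- Pure tensors in the bimodule `X ⊗_B A/B`. -/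
def twistMk (x : X) (v : quotBimod B) : twist B X := twistTmul B x v

theorem lact_twistMk (a : A) (x : X) (v : quotBimod B) :
    lact a (twistMk B x v) = twistMk B (lact a x) v :=
  (bimodOf_lact (twistSpace B X) _ _ (twistAct_commute B X) a _).trans (twistLeft_twistTmul B a x v)

theorem twistMk_ract (x : X) (c a : A) :
    ract (twistMk B x (proj B c)) a =
      twistMk B x (proj B (c * a)) - twistMk B (ract x c) (proj B a) :=
  (bimodOf_ract (twistSpace B X) _ _ (twistAct_commute B X) a _).trans
    (twistRight_twistTmul B a x c)

theorem twistMk_add (x : X) (v w : quotBimod B) :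
    twistMk B x (v + w) = twistMk B x v + twistMk B x w := twistTmul_add B x v w

theorem add_twistMk (x y : X) (v : quotBimod B) :
    twistMk B (x + y) v = twistMk B x v + twistMk B y v := add_twistTmul B x y v

@[simp]
theorem twistMk_zero (x : X) : twistMk B x 0 = 0 := twistTmul_zero B x

theorem ract_twistMk (x : X) (b : B) (v : quotBimod B) :
    twistMk B (ract x (b : A)) v = twistMk B x (lact b v) := ract_twistTmul B x b v

theorem twistMk_smul (c : k) (x : X) (v : quotBimod B) :
    twistMk B x (c • v) = c • twistMk B x v := by
  rw [← algebraMap_lact, ← algebraMap_lact, lact_twistMk, algebraMap_lact c x,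
    ← ract_algebraMap]
  exact (ract_twistMk B x (algebraMap k B c) _).symm

/-- Since `π(b) = 0`, the correction term disappears: over `B` the twisted action is the usual one
on `A/B`. The twist can therefore replace `X ⊗_B A/B` inside tensor products over `B`. -/
theorem twistMk_ract_coe (x : X) (v : quotBimod B) (b : B) :
    ract (twistMk B x v) (b : A) = twistMk B x (ract v b) := by
  obtain ⟨a, rfl⟩ := proj_surjective B v
  rw [twistMk_ract, proj_coe, twistMk_zero, sub_zero, proj_ract]

theorem twist_induction {p : twist B X → Prop} (zero : p 0)
    (tmul : ∀ x a, p (twistMk B x (proj B a))) (add : ∀ z w, p z → p w → p (z + w))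
    (z : twist B X) : p z := twistSpace_induction B zero tmul add z

theorem twist_addHom_ext {Z : Type*} [AddCommGroup Z] {f g : twist B X →+ Z}
    (h : ∀ x a, f (twistMk B x (proj B a)) = g (twistMk B x (proj B a))) : f = g := by
  ext z
  induction z using twist_induction with
  | zero => simp
  | tmul x a => exact h x a
  | add z w hz hw => rw [map_add, map_add, hz, hw]

/-- The additive map out of the bimodule `X ⊗_B A/B` given by a balanced biadditive map on
`X × A` that vanishes on `X × B`. -/
def twistAddLift {Z : Type u} [AddCommGroup Z] [Module k Z] (f : X →+ A →+ Z)
    (hk : ∀ (c : k) (x : X) (a : A), f x (c • a) = c • f x a)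
    (hb : ∀ (x : X) (b : B) (a : A), f (ract x (b : A)) a = f x (b * a))
    (h0 : ∀ (x : X) (b : B), f x b = 0) : twist B X →+ Z :=
  (twistLift B f hk hb h0).toAddMonoidHom

theorem twistAddLift_twistMk {Z : Type u} [AddCommGroup Z] [Module k Z] (f : X →+ A →+ Z)
    (hk : ∀ (c : k) (x : X) (a : A), f x (c • a) = c • f x a)
    (hb : ∀ (x : X) (b : B) (a : A), f (ract x (b : A)) a = f x (b * a))
    (h0 : ∀ (x : X) (b : B), f x b = 0) (x : X) (a : A) :
    twistAddLift B f hk hb h0 (twistMk B x (proj B a)) = f x a :=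
  twistLift_twistTmul B f hk hb h0 x a

end Twist

/-! ### Tensor products over `B^e` and absorption of one factor `A/B` into the coefficients. -/

section EnvTensor

variable {k : Type u} [Field k] {A : Type u} [Ring A] [Algebra k A] (B : Subalgebra k A)
variable (X Y : ModuleCat.{u} (Env k A)) (V : ModuleCat.{u} (Env k B))

/-- The vector space `X ⊗_{B^e} V`. -/
abbrev envTensor : ModuleCat.{u} k :=
  tensorOver k (Env k B) (toRightEnv (resBimod B X)) V

variable {X Y V}

/-- Pure tensors in `X ⊗_{B^e} V`. -/
def envTmul (x : X) (v : V) : envTensor B X V :=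
  tmulOver k (M := toRightEnv (resBimod B X)) x v

theorem envTmul_add (x : X) (v w : V) :
    envTmul B x (v + w) = envTmul B x v + envTmul B x w :=
  tmulOver_add k (M := toRightEnv (resBimod B X)) x v w

theorem add_envTmul (x y : X) (v : V) :
    envTmul B (x + y) v = envTmul B x v + envTmul B y v :=
  add_tmulOver k (M := toRightEnv (resBimod B X)) x y v

theorem envTmul_smul (c : k) (x : X) (v : V) : envTmul B x (c • v) = c • envTmul B x v :=
  tmulOver_algebraMap_smul k (M := toRightEnv (resBimod B X)) c x v

theorem ract_envTmul (x : X) (b : B) (v : V) :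
    envTmul B (ract x (b : A)) v = envTmul B x (lact b v) :=
  tmulOver_smul k (M := toRightEnv (resBimod B X)) x (b ⊗ₜ[k] op 1) v

theorem lact_envTmul (b : B) (x : X) (v : V) :
    envTmul B (lact (b : A) x) v = envTmul B x (ract v b) :=
  tmulOver_smul k (M := toRightEnv (resBimod B X)) x ((1 : B) ⊗ₜ[k] op b) v

theorem smul_envTmul (c : k) (x : X) (v : V) : envTmul B (c • x) v = c • envTmul B x v := by
  rw [← ract_algebraMap, ← envTmul_smul]
  exact ract_envTmul B x (algebraMap k B c) v

theorem envTensor_induction {p : envTensor B X V → Prop} (zero : p 0)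
    (tmul : ∀ x v, p (envTmul B x v)) (add : ∀ z w, p z → p w → p (z + w))
    (z : envTensor B X V) : p z :=
  tensorOver_induction (M := toRightEnv (resBimod B X)) zero tmul add z

theorem envTensor_ext {Z : Type*} [AddCommGroup Z] [Module k Z] {f g : envTensor B X V →ₗ[k] Z}
    (h : ∀ x v, f (envTmul B x v) = g (envTmul B x v)) : f = g := by
  ext z
  induction z using envTensor_induction with
  | zero => simp
  | tmul x a => exact h x a
  | add z w hz hw => rw [map_add, map_add, hz, hw]

/-- The linear map out of `X ⊗_{B^e} V` given by a balanced biadditive map. -/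
def envLift {Z : Type u} [AddCommGroup Z] [Module k Z] (f : X →+ V →+ Z)
    (hk : ∀ (c : k) (x : X) (v : V), f x (c • v) = c • f x v)
    (hr : ∀ (x : X) (b : B) (v : V), f (ract x (b : A)) v = f x (lact b v))
    (hl : ∀ (x : X) (b : B) (v : V), f (lact (b : A) x) v = f x (ract v b)) :
    envTensor B X V →ₗ[k] Z :=
  liftOver (M := toRightEnv (resBimod B X)) f hk fun x r v => by
    induction r using TensorProduct.induction_on generalizing x v with
    | zero =>
      refine (DFunLike.congr_fun ((congrArg f (zero_smul (Env k B)ᵐᵒᵖ x)).trans (map_zero f))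
        v).trans ?_
      exact ((congrArg (f x) (zero_smul (Env k B) v)).trans (map_zero _)).symm
    | tmul b b' =>
      -- A pure tensor acts from the right by `x ↦ b' x b`, so balancedness over `B^e` splits into
      -- the two one-sided conditions `hr` and `hl`.
      have h : op (b ⊗ₜ[k] b' : Env k B) • x =
          ract (X := X) (lact (X := X) (b'.unop : A) x) (b : A) := by
        change (b'.unop ⊗ₜ[k] op b : Env k B) • (show resBimod B X from x) = _
        rw [env_smul_eq, lact_ract]
        rfl
      rw [h, env_smul_eq, lact_ract]
      exact (hr (lact (X := X) (b'.unop : A) x) b v).trans (hl x b'.unop _)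
    | add r s hr hs =>
      refine (DFunLike.congr_fun ((congrArg f (add_smul (op r) (op s) x)).trans (map_add f _ _))
        v).trans ?_
      rw [add_smul, map_add]
      exact congrArg₂ (· + ·) (hr x v) (hs x v)

/-- Pure tensors as a biadditive map. -/
def envTmulHom : X →+ V →+ envTensor B X V :=
  tmulHom (toRightEnv (resBimod B X)) V

@[simp]
theorem envTmulHom_apply (x : X) (v : V) : envTmulHom B x v = envTmul B x v := rfl

/-- The map `h ⊗ id : X ⊗_{B^e} V → Y ⊗_{B^e} V` for a map `h` of `B`-bimodules. -/
def envMapLeft (h : X →+ Y) (hl : ∀ (b : B) x, h (lact (b : A) x) = lact (b : A) (h x))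
    (hr : ∀ x (b : B), h (ract x (b : A)) = ract (h x) (b : A)) :
    envTensor B X V →ₗ[k] envTensor B Y V :=
  envLift B ((envTmulHom B).comp h)
    (fun c x v => envTmul_smul B c (h x) v)
    (fun x b v => by simp [hr, ract_envTmul])
    (fun x b v => by simp [hl, lact_envTmul])

@[simp]
theorem envTmul_zero (x : X) : envTmul B x (0 : V) = 0 := map_zero (envTmulHom B x)

@[simp]
theorem zero_envTmul (v : V) : envTmul B (0 : X) v = 0 :=
  DFunLike.congr_fun (map_zero (envTmulHom B)) v

/-- The map `v ⊗ n ↦ (x ⊗ v) ⊗ n` for a fixed `x`. -/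
def assocFun (x : X) : bimodTensor (quotBimod B) V →+ envTensor B (twist B X) V :=
  bimodLift (biaddHom (fun v n => envTmul B (twistMk B x v) n)
      (fun v n m => envTmul_add B _ n m)
      (fun v w n => by rw [twistMk_add, add_envTmul]))
    (fun c v n => envTmul_smul B c (twistMk B x v) n)
    (fun v b n => by
      rw [biaddHom_apply, biaddHom_apply, ← twistMk_ract_coe, ract_envTmul])

theorem assocFun_bimodTmul (x : X) (v : quotBimod B) (n : V) :
    assocFun B x (bimodTmul v n) = envTmul B (twistMk B x v) n := rfl

/-- The isomorphism `X ⊗_{B^e} (A/B ⊗_B V) → (X ⊗_B A/B) ⊗_{B^e} V`. -/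
def assocHom : envTensor B X (bimodTensor (quotBimod B) V) →ₗ[k] envTensor B (twist B X) V :=
  envLift B
    (AddMonoidHom.mk' (assocFun B)
      (fun x y => bimodTensor_addHom_ext fun v n => by
        rw [AddMonoidHom.add_apply, assocFun_bimodTmul, assocFun_bimodTmul, assocFun_bimodTmul,
          add_twistMk, add_envTmul]))
    (fun c x t => by
      rw [AddMonoidHom.mk'_apply]
      induction t using bimodTensor_induction with
      | zero => simp
      | tmul v n =>
        rw [← ract_algebraMap, ract_bimodTmul, ract_algebraMap, assocFun_bimodTmul,
          assocFun_bimodTmul, envTmul_smul]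
      | add s t hs ht => rw [smul_add, map_add, map_add, hs, ht, smul_add])
    (fun x b t => by
      simp only [AddMonoidHom.mk'_apply]
      induction t using bimodTensor_induction with
      | zero => simp
      | tmul v n => rw [lact_bimodTmul, assocFun_bimodTmul, assocFun_bimodTmul, ract_twistMk]
      | add s t hs ht => rw [lact_add, map_add, map_add, hs, ht])
    (fun x b t => by
      simp only [AddMonoidHom.mk'_apply]
      induction t using bimodTensor_induction with
      | zero => simp
      | tmul v n =>
        rw [ract_bimodTmul, assocFun_bimodTmul, assocFun_bimodTmul, ← lact_twistMk, lact_envTmul]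
      | add s t hs ht => rw [add_ract, map_add, map_add, hs, ht])

theorem assocHom_envTmul (x : X) (v : quotBimod B) (n : V) :
    assocHom B (envTmul B x (bimodTmul v n)) = envTmul B (twistMk B x v) n := rfl

/-- The map `(x ⊗ v) ↦ x ⊗ (v ⊗ n)` for a fixed `n`. -/
def assocInvFun (n : V) : twist B X →+ envTensor B X (bimodTensor (quotBimod B) V) :=
  twistAddLift B (biaddHom (fun x a => envTmul B x (bimodTmul (proj B a) n))
      (fun x a a' => by rw [proj_add, add_bimodTmul, envTmul_add])
      (fun x y a => add_envTmul B x y _))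
    (fun c x a => by
      rw [biaddHom_apply, biaddHom_apply, ← envTmul_smul, proj_smul, ← algebraMap_lact,
        ← lact_bimodTmul, algebraMap_lact])
    (fun x b a => by
      rw [biaddHom_apply, biaddHom_apply, ract_envTmul, lact_bimodTmul, lact_proj])
    (fun x b => by
      have : bimodTmul (0 : quotBimod B) n = 0 :=
        zero_tmulOver k (M := toRight (quotBimod B)) (N := toLeft V) n
      rw [biaddHom_apply, proj_coe, this, envTmul_zero])

theorem assocInvFun_twistMk (n : V) (x : X) (v : quotBimod B) :
    assocInvFun B n (twistMk B x v) = envTmul B x (bimodTmul v n) := by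
  obtain ⟨a, rfl⟩ := proj_surjective B v
  exact twistAddLift_twistMk B _ _ _ _ x a

/-- The isomorphism `(X ⊗_B A/B) ⊗_{B^e} V → X ⊗_{B^e} (A/B ⊗_B V)`. -/
def assocInv : envTensor B (twist B X) V →ₗ[k] envTensor B X (bimodTensor (quotBimod B) V) :=
  envLift B (biaddHom (fun w n => assocInvFun B n w)
      (fun w n m => by
        refine DFunLike.congr_fun (f := assocInvFun B (n + m))
          (g := assocInvFun B n + assocInvFun B m) (twist_addHom_ext B fun x a => ?_) w
        rw [AddMonoidHom.add_apply, assocInvFun_twistMk, assocInvFun_twistMk,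
          assocInvFun_twistMk, bimodTmul_add, envTmul_add])
      (fun w w' n => map_add _ w w'))
    (fun c w n => by
      rw [biaddHom_apply, biaddHom_apply]
      induction w using twist_induction with
      | zero => simp
      | tmul x a =>
        rw [assocInvFun_twistMk, assocInvFun_twistMk, ← envTmul_smul, ← ract_algebraMap,
          ← ract_bimodTmul, ract_algebraMap]
      | add s t hs ht => rw [map_add, map_add, hs, ht, smul_add])
    (fun w b n => by
      rw [biaddHom_apply, biaddHom_apply]
      induction w using twist_induction with
      | zero => simp
      | tmul x a =>
        rw [twistMk_ract_coe, assocInvFun_twistMk, assocInvFun_twistMk, bimodTmul_balanced]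
      | add s t hs ht => rw [add_ract, map_add, map_add, hs, ht])
    (fun w b n => by
      rw [biaddHom_apply, biaddHom_apply]
      induction w using twist_induction with
      | zero => simp
      | tmul x a =>
        rw [lact_twistMk, assocInvFun_twistMk, assocInvFun_twistMk, lact_envTmul, ract_bimodTmul]
      | add s t hs ht => rw [lact_add, map_add, map_add, hs, ht])

theorem assocInv_envTmul (x : X) (v : quotBimod B) (n : V) :
    assocInv B (envTmul B (twistMk B x v) n) = envTmul B x (bimodTmul v n) :=
  assocInvFun_twistMk B n x v

theorem assocInv_assocHom (z : envTensor B X (bimodTensor (quotBimod B) V)) :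
    assocInv B (assocHom B z) = z := by
  induction z using envTensor_induction with
  | zero => simp
  | tmul x t =>
    induction t using bimodTensor_induction with
    | zero => simp
    | tmul v n => rw [assocHom_envTmul, assocInv_envTmul]
    | add s t hs ht => rw [envTmul_add, map_add, map_add, hs, ht]
  | add z w hz hw => rw [map_add, map_add, hz, hw]

theorem assocHom_assocInv (z : envTensor B (twist B X) V) :
    assocHom B (assocInv B z) = z := by
  induction z using envTensor_induction with
  | zero => simp
  | tmul w n =>
    induction w using twist_induction with
    | zero => simp
    | tmul x a => rw [assocInv_envTmul, assocHom_envTmul]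
    | add s t hs ht => rw [add_envTmul, map_add, map_add, hs, ht]
  | add z w hz hw => rw [map_add, map_add, hz, hw]

end EnvTensor

/-! ### Degree zero: coinvariants as `X ⊗_{B^e} B`. -/

section Coinvariants

variable {k : Type u} [Field k] {A : Type u} [Ring A] [Algebra k A] (B : Subalgebra k A)
variable {X : ModuleCat.{u} (Env k A)}

theorem coinvariantsMk_lact (b : B) (x : X) :
    coinvariantsMk B (lact (b : A) x) = coinvariantsMk B (ract x (b : A)) :=
  (Submodule.Quotient.eq _).2 (Submodule.subset_span ⟨b, x, rfl⟩)

/-- The linear map out of `X_B` given by a map on `X` that vanishes on commutators. -/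
def coinvariantsLift {Z : Type*} [AddCommGroup Z] [Module k Z] (f : X →ₗ[k] Z)
    (hf : ∀ (b : B) x, f (lact (b : A) x) = f (ract x (b : A))) :
    coinvariants B X →ₗ[k] Z :=
  Submodule.liftQ _ f (by
    refine Submodule.span_le.2 ?_
    rintro _ ⟨b, x, rfl⟩
    simp [hf])

variable (X) in
/-- The projection `X → X_B`. -/
def coinvariantsProj : X →ₗ[k] coinvariants B X := Submodule.mkQ _

@[simp]
theorem coinvariantsProj_apply (x : X) : coinvariantsProj B X x = coinvariantsMk B x := rfl

variable (X) in
/-- The map `X_B → X ⊗_{B^e} B`, `x ↦ x ⊗ 1`. -/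
def coinvariantsHom : coinvariants B X →ₗ[k] envTensor B X (selfBimod k B) :=
  coinvariantsLift B
    { toFun := fun x => envTmul B x (selfMk 1)
      map_add' := fun x y => add_envTmul B x y _
      map_smul' := fun c x => smul_envTmul B c x _ }
    (fun b x => by
      change envTmul B _ _ = envTmul B _ _
      rw [lact_envTmul, ract_envTmul, lact_selfMk, ract_selfMk, one_mul, mul_one])

theorem coinvariantsHom_mk (x : X) :
    coinvariantsHom B X (coinvariantsMk B x) = envTmul B x (selfMk 1) := rfl

variable (X) in
/-- The map `X ⊗_{B^e} B → X_B`, `x ⊗ b ↦ x b`. -/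
def coinvariantsInv : envTensor B X (selfBimod k B) →ₗ[k] coinvariants B X :=
  envLift B
    (biaddHom (fun x (b : selfBimod k B) => coinvariantsProj B X (ract x ((show B from b) : A)))
      (fun x b b' => by
        rw [← map_add, ← ract_add]; rfl)
      (fun x y b => by rw [add_ract, map_add]))
    (fun c x b => by
      obtain ⟨b, rfl⟩ := selfMk_surjective b
      rw [smul_selfMk]
      change coinvariantsProj B X (ract x (c • (b : A))) = c • coinvariantsProj B X (ract x (b : A))
      rw [ract_smul, map_smul])
    (fun x b b' => by
      obtain ⟨b', rfl⟩ := selfMk_surjective b'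
      rw [lact_selfMk]
      change coinvariantsProj B X (ract (ract x (b : A)) (b' : A)) =
        coinvariantsProj B X (ract x ((b : A) * (b' : A)))
      rw [ract_ract])
    (fun x b b' => by
      obtain ⟨b', rfl⟩ := selfMk_surjective b'
      rw [ract_selfMk]
      change coinvariantsMk B (ract (lact (b : A) x) (b' : A)) =
        coinvariantsMk B (ract x ((b' : A) * (b : A)))
      rw [← lact_ract, coinvariantsMk_lact, ract_ract])

theorem coinvariantsInv_envTmul (x : X) (b : B) :
    coinvariantsInv B X (envTmul B x (selfMk b)) = coinvariantsMk B (ract x (b : A)) := rfl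

theorem coinvariantsHom_inv (z : envTensor B X (selfBimod k B)) :
    coinvariantsHom B X (coinvariantsInv B X z) = z := by
  induction z using envTensor_induction with
  | zero => simp
  | tmul x b =>
    obtain ⟨b, rfl⟩ := selfMk_surjective b
    rw [coinvariantsInv_envTmul, coinvariantsHom_mk, ract_envTmul, lact_selfMk, mul_one]
  | add z w hz hw => rw [map_add, map_add, hz, hw]

theorem coinvariantsInv_hom (z : coinvariants B X) :
    coinvariantsInv B X (coinvariantsHom B X z) = z := by
  obtain ⟨x, rfl⟩ := Submodule.Quotient.mk_surjective _ z
  refine (coinvariantsInv_envTmul B x 1).trans ?_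
  rw [OneMemClass.coe_one, ract_one]
  rfl

variable (X) in
/-- The isomorphism `X_B ≅ X ⊗_{B^e} B`. -/
def coinvariantsIso : coinvariants B X ≅ relChain B X 0 :=
  LinearEquiv.toModuleIso (LinearEquiv.ofLinearMap (coinvariantsHom B X) (coinvariantsInv B X)
    (LinearMap.ext (coinvariantsHom_inv B)) (LinearMap.ext (coinvariantsInv_hom B)))

end Coinvariants

/-! ### Contractions of a tuple, separated from its first entry. -/

theorem contractNth_zero_eq_cons {α : Type*} {n : ℕ} (op : α → α → α) (g : Fin (n + 2) → α) :
    Fin.contractNth 0 op g = Fin.cons (op (g 0) (g 1)) (Fin.tail (Fin.tail g)) := by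
  ext i
  refine Fin.cases ?_ (fun i => ?_) i
  · simp [Fin.contractNth]
  · simp [Fin.contractNth, Fin.tail]

/-- A contraction away from the first entry leaves that entry alone. This matches the later terms of
the boundary for `X` with those for the twist, where the first entry is part of the coefficient. -/
theorem contractNth_succ_eq_cons {α : Type*} {n : ℕ} (op : α → α → α) (j : Fin (n + 1))
    (g : Fin (n + 2) → α) :
    Fin.contractNth j.succ op g = Fin.cons (g 0) (Fin.contractNth j op (Fin.tail g)) := by
  ext i
  refine Fin.cases ?_ (fun i => ?_) i
  · simp [Fin.contractNth]
  · simp [Fin.contractNth, Fin.tail, ← Fin.succ_castSucc, - Fin.castSucc_succ]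

/-! ### The boundary map by recursion on the degree. -/

section Boundary

variable {k : Type u} [Field k] {A : Type u} [Ring A] [Algebra k A] (B : Subalgebra k A)
variable {X Y : ModuleCat.{u} (Env k A)}

theorem add_relChainMk {n : ℕ} (x y : X) (α : Fin n → quotBimod B) :
    relChainMk B (x + y) α = relChainMk B x α + relChainMk B y α :=
  add_envTmul B x y (bimodPowMk n α)

theorem zero_relChainMk {n : ℕ} (α : Fin n → quotBimod B) :
    relChainMk B (0 : X) α = 0 :=
  zero_envTmul B (bimodPowMk n α)

theorem sub_relChainMk {n : ℕ} (x y : X) (α : Fin n → quotBimod B) :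
    relChainMk B (x - y) α = relChainMk B x α - relChainMk B y α := by
  rw [eq_sub_iff_add_eq, ← add_relChainMk, sub_add_cancel]

variable (X) in
/-- The isomorphism `C_{n+1}(A|B, X) → C_n(A|B, X ⊗_B A/B)`. -/
def relChainAssoc (n : ℕ) : relChain B X (n + 1) →ₗ[k] relChain B (twist B X) n :=
  assocHom B (V := bimodPow (quotBimod B) n)

variable (X) in
/-- The isomorphism `C_n(A|B, X ⊗_B A/B) → C_{n+1}(A|B, X)`. -/
def relChainAssocInv (n : ℕ) : relChain B (twist B X) n →ₗ[k] relChain B X (n + 1) :=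
  assocInv B (V := bimodPow (quotBimod B) n)

theorem relChainAssoc_mk {n : ℕ} (x : X) (α : Fin (n + 1) → quotBimod B) :
    relChainAssoc B X n (relChainMk B x α) =
      relChainMk B (twistMk B x (α 0)) (Fin.tail α) := rfl

theorem relChainAssocInv_mk {n : ℕ} (x : X) (v : quotBimod B) (α : Fin n → quotBimod B) :
    relChainAssocInv B X n (relChainMk B (twistMk B x v) α) = relChainMk B x (Fin.cons v α) :=
  assocInv_envTmul B x v (bimodPowMk n α)

@[simp]
theorem relChainAssocInv_assoc {n : ℕ} (z : relChain B X (n + 1)) :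
    relChainAssocInv B X n (relChainAssoc B X n z) = z :=
  assocInv_assocHom B (V := bimodPow (quotBimod B) n) z

@[simp]
theorem relChainAssoc_inv {n : ℕ} (z : relChain B (twist B X) n) :
    relChainAssoc B X n (relChainAssocInv B X n z) = z :=
  assocHom_assocInv B (V := bimodPow (quotBimod B) n) z

/-- The first factor is absorbed into the coefficients until degree zero is reached, where `x ⊗ b =
xb ⊗ 1`; hence pure tensors span additively. -/
theorem relChain_induction {n : ℕ} {p : relChain B X n → Prop} (zero : p 0)
    (mk : ∀ (x : X) (α : Fin n → quotBimod B), p (relChainMk B x α))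
    (add : ∀ z w, p z → p w → p (z + w)) (z : relChain B X n) : p z := by
  induction n generalizing X with
  | zero =>
    refine envTensor_induction B (V := selfBimod k B) zero (fun x b => ?_) add z
    obtain ⟨b, rfl⟩ := selfMk_surjective b
    have h' : envTmul B x (selfMk b) = envTmul B (ract x (b : A)) (selfMk 1) := by
      rw [ract_envTmul, lact_selfMk, mul_one]
    rw [h']
    exact mk (ract x (b : A)) Fin.elim0
  | succ n ih =>
    rw [← relChainAssocInv_assoc B z]
    refine ih (p := fun w => p (relChainAssocInv B X n w)) (by simpa using zero) (fun w α => ?_)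
      (fun z w hz hw => by rw [map_add]; exact add _ _ hz hw) _
    induction w using twist_induction with
    | zero => simpa [zero_relChainMk] using zero
    | tmul x a =>
      rw [relChainAssocInv_mk]
      exact mk x _
    | add s t hs ht => rw [add_relChainMk, map_add]; exact add _ _ hs ht

theorem relChain_hom_ext {n : ℕ} {Z : Type*} [AddCommGroup Z] [Module k Z]
    {f g : relChain B X n →ₗ[k] Z}
    (h : ∀ (x : X) (α : Fin n → quotBimod B), f (relChainMk B x α) = g (relChainMk B x α)) :
    f = g := by
  ext z
  induction z using relChain_induction with
  | zero => simp
  | mk x α => exact h x α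
  | add z w hz hw => rw [map_add, map_add, hz, hw]

variable (X) in
/-- The map `X ⊗_B A/B → X_B`, `x ⊗ π(a) ↦ x a - a x`. -/
def commutatorHom : twist B X →+ coinvariants B X :=
  twistAddLift B (biaddHom (fun x a => coinvariantsMk B (ract x a - lact a x))
      (fun x a a' => by
        simp only [← coinvariantsProj_apply, ← map_add]
        rw [ract_add, add_lact]; congr 1; abel)
      (fun x y a => by
        simp only [← coinvariantsProj_apply, ← map_add]
        rw [add_ract, lact_add]; congr 1; abel))
    (fun c x a => by
      simp only [biaddHom_apply, ← coinvariantsProj_apply, ← map_smul, ract_smul, smul_lact,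
        smul_sub])
    -- The balancing condition and the vanishing on `B` hold only modulo commutators with `B`: they
    -- amount to `axb ∼ bax` and `xb ∼ bx`. This is why the target is `X_B` rather than `X`.
    (fun x b a => by
      simp only [biaddHom_apply, ← coinvariantsProj_apply, map_sub, ract_ract]
      congr 1
      rw [lact_ract, ← lact_lact]
      exact (coinvariantsMk_lact B b (lact a x)).symm)
    (fun x b => by
      simp only [biaddHom_apply, ← coinvariantsProj_apply, map_sub]
      exact sub_eq_zero.2 (coinvariantsMk_lact B b x).symm)

theorem commutatorHom_twistMk (x : X) (a : A) :
    commutatorHom B X (twistMk B x (proj B a)) = coinvariantsMk B (ract x a - lact a x) :=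
  twistAddLift_twistMk B _ _ _ _ x a

theorem commutatorHom_smul (c : k) (w : twist B X) :
    commutatorHom B X (c • w) = c • commutatorHom B X w := by
  induction w using twist_induction with
  | zero => simp
  | tmul x a =>
    rw [← twistMk_smul, ← proj_smul, commutatorHom_twistMk, commutatorHom_twistMk, ract_smul,
      smul_lact, ← smul_sub]
    rfl
  | add s t hs ht => rw [smul_add, map_add, map_add, hs, ht, smul_add]

variable (X) in
/-- The map `(X ⊗_B A/B)_B → X_B`, `x ⊗ π(a) ↦ x a - a x`. -/
def coinvariantsBoundary : coinvariants B (twist B X) →ₗ[k] coinvariants B X :=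
  coinvariantsLift B
    { commutatorHom B X with map_smul' := commutatorHom_smul B } fun b w => by
      change commutatorHom B X _ = commutatorHom B X _
      induction w using twist_induction with
      | zero => simp
      | tmul x a =>
        rw [lact_twistMk, twistMk_ract_coe, proj_ract, commutatorHom_twistMk,
          commutatorHom_twistMk]
        simp only [← coinvariantsProj_apply, map_sub]
        rw [← lact_lact a, ← ract_ract, ← lact_ract]
        exact congrArg (· - _) (coinvariantsMk_lact B b (ract x a))
      | add s t hs ht => rw [lact_add, add_ract, map_add, map_add, hs, ht]

theorem coinvariantsBoundary_twistMk (x : X) (a : A) :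
    coinvariantsBoundary B X (coinvariantsMk B (twistMk B x (proj B a))) =
      coinvariantsMk B (ract x a - lact a x) := commutatorHom_twistMk B x a

/-- The boundary `b_{A|B} : C_{n+1}(A|B, X) → C_n(A|B, X)`. -/
def relBoundary : ∀ (n : ℕ) (X : ModuleCat.{u} (Env k A)),
    relChain B X (n + 1) →ₗ[k] relChain B X n
  | 0, X => coinvariantsHom B X ∘ₗ coinvariantsBoundary B X ∘ₗ coinvariantsInv B (twist B X) ∘ₗ
      relChainAssoc B X 0
  -- Absorbing `α₁` lowers every index by one, so the surviving terms change sign. The leading term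
  -- for the twist is `x ⊗ π(σ(α₁)σ(α₂)) - xσ(α₁) ⊗ α₂`, whose negative supplies the first
  -- contraction with sign `-1` and the leading term with sign `+1`.
  | n + 1, X => -(relChainAssocInv B X n ∘ₗ relBoundary n (twist B X) ∘ₗ relChainAssoc B X (n + 1))

theorem coinvariantsInv_relChainMk (x : X) (α : Fin 0 → quotBimod B) :
    coinvariantsInv B X (relChainMk B x α) = coinvariantsMk B x :=
  coinvariantsInv_hom B (coinvariantsMk B x)

/-- The representative `a` is arbitrary: changing it by `b ∈ B` changes the value by the class of
`xb - bx`, which is zero. -/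
theorem relBoundary_zero_mk (x : X) (a : A) (α : Fin 0 → quotBimod B) :
    relBoundary B 0 X (relChainMk B x (Fin.cons (proj B a) α)) =
      relChainMk B (ract x a - lact a x) Fin.elim0 := by
  change coinvariantsHom B X (coinvariantsBoundary B X (coinvariantsInv B (twist B X)
    (relChainMk B (twistMk B x (proj B a)) α))) = _
  rw [coinvariantsInv_relChainMk, coinvariantsBoundary_twistMk]
  rfl

theorem relBoundary_succ (n : ℕ) (z : relChain B X (n + 2)) :
    relBoundary B (n + 1) X z =
      -relChainAssocInv B X n (relBoundary B n (twist B X) (relChainAssoc B X (n + 1) z)) := rfl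

variable (X) in
/-- The boundary maps are given by the formula of `IsRelBoundary`, for every section. -/
theorem isRelBoundary_relBoundary (σ : LinearSection B) :
    IsRelBoundary B X σ (fun n => ModuleCat.ofHom (relBoundary B n X)) := by
  intro n
  change ∀ (x : X) (α : Fin (n + 1) → quotBimod B), relBoundary B n X (relChainMk B x α) = _
  induction n generalizing X with
  | zero =>
    intro x α
    -- The representative of `α 0` is taken to be its value under `σ`, which produces the formula
    -- for this particular section.
    have h : α = Fin.cons (proj B (σ.toMap (α 0))) (Fin.tail α) := by
      rw [σ.proj_toMap, Fin.cons_self_tail]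
    conv_lhs => rw [h]
    rw [relBoundary_zero_mk, sub_relChainMk]
    simp only [Finset.univ_eq_empty, Finset.sum_empty, add_zero, zero_add, pow_one, neg_smul,
      one_smul, sub_eq_add_neg]
    congr 2
    exact Subsingleton.elim _ _
  | succ n ih =>
    intro x α
    rw [relBoundary_succ, relChainAssoc_mk, ih, map_add, map_add, map_sum, Fin.sum_univ_succ]
    -- The twisted right action splits the leading term for the twist into the first contraction
    -- minus the leading term for `X`.
    have h0 : relChainAssocInv B X n (relChainMk B
        (ract (twistMk B x (α 0)) (σ.toMap (Fin.tail α 0))) (Fin.tail (Fin.tail α))) =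
        relChainMk B x (Fin.contractNth (Fin.castSucc 0)
          (fun β γ => proj B (σ.toMap β * σ.toMap γ)) α) -
        relChainMk B (ract x (σ.toMap (α 0))) (Fin.tail α) := by
      conv_lhs => rw [← σ.proj_toMap (α 0), twistMk_ract, σ.proj_toMap (Fin.tail α 0),
        sub_relChainMk, map_sub, relChainAssocInv_mk, relChainAssocInv_mk, Fin.cons_self_tail]
      rw [Fin.castSucc_zero, contractNth_zero_eq_cons]
      rfl
    have h1 (i : Fin n) : relChainAssocInv B X n ((-1 : ℤ) ^ ((i : ℕ) + 1) •
        relChainMk B (twistMk B x (α 0)) (Fin.contractNth i.castSucc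
          (fun β γ => proj B (σ.toMap β * σ.toMap γ)) (Fin.tail α))) =
        -((-1 : ℤ) ^ ((i.succ : ℕ) + 1) • relChainMk B x (Fin.contractNth i.succ.castSucc
          (fun β γ => proj B (σ.toMap β * σ.toMap γ)) α)) := by
      rw [map_zsmul, relChainAssocInv_mk, ← Fin.succ_castSucc, contractNth_succ_eq_cons,
        Fin.val_succ, pow_succ _ ((i : ℕ) + 1)]
      simp
    have h2 : relChainAssocInv B X n ((-1 : ℤ) ^ (n + 1) •
        relChainMk B (lact (σ.toMap (Fin.tail α (Fin.last n))) (twistMk B x (α 0)))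
          (Fin.init (Fin.tail α))) =
        -((-1 : ℤ) ^ (n + 1 + 1) • relChainMk B (lact (σ.toMap (α (Fin.last (n + 1)))) x)
          (Fin.init α)) := by
      rw [map_zsmul, lact_twistMk, relChainAssocInv_mk, pow_succ _ (n + 1)]
      have : (Fin.cons (α 0) (Fin.init (Fin.tail α)) : Fin (n + 1) → quotBimod B) =
          Fin.init α := by
        ext i
        refine Fin.cases rfl (fun i => rfl) i
      rw [this]
      simp [Fin.tail]
    rw [h0, h2, Finset.sum_congr rfl fun i _ => h1 i, Finset.sum_neg_distrib]
    simp only [Fin.val_zero, zero_add, pow_one, neg_smul, one_smul]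
    abel

/-- The same maps satisfy the formula for every `σ`, and the formula determines a family on spanning
elements; existence, uniqueness and independence of `σ` are all contained in this equivalence. -/
theorem isRelBoundary_iff (σ : LinearSection B)
    (b : ∀ n, relChain B X (n + 1) ⟶ relChain B X n) :
    IsRelBoundary B X σ b ↔ b = fun n => ModuleCat.ofHom (relBoundary B n X) := by
  constructor
  · intro h
    ext n : 2
    refine relChain_hom_ext B fun x α => ?_
    exact (h n x α).trans (isRelBoundary_relBoundary B X σ n x α).symm
  · rintro rfl
    exact isRelBoundary_relBoundary B X σ

/-- In the inductive step the two minus signs and the inner pair of associativity isomorphisms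
cancel, leaving the square of the boundary for the twist. In the base case `x ⊗ π(a) ⊗ π(c)` goes to
the commutators of `x` with `ac`, of `xa` with `c` and of `cx` with `a`, with signs `-`, `+`, `+`,
and these cancel. -/
theorem relBoundary_relBoundary (n : ℕ) (z : relChain B X (n + 2)) :
    relBoundary B n X (relBoundary B (n + 1) X z) = 0 := by
  induction n generalizing X with
  | zero =>
    rw [relBoundary_succ, map_neg, neg_eq_zero]
    refine LinearMap.congr_fun (f := relBoundary B 0 X ∘ₗ relChainAssocInv B X 0 ∘ₗ
      relBoundary B 0 (twist B X) ∘ₗ relChainAssoc B X 1) (g := 0)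
      (relChain_hom_ext B fun x α => ?_) z
    obtain ⟨a, ha⟩ := proj_surjective B (α 0)
    obtain ⟨c, hc⟩ := proj_surjective B (α 1)
    have h : Fin.tail α = Fin.cons (proj B c) Fin.elim0 := by
      ext i
      rw [Subsingleton.elim i 0]
      exact hc.symm
    simp only [LinearMap.comp_apply, relChainAssoc_mk, h, ← ha, relBoundary_zero_mk,
      sub_relChainMk, map_sub, twistMk_ract, lact_twistMk, relChainAssocInv_mk, ract_ract,
      lact_lact, lact_ract, LinearMap.zero_apply]
    abel
  | succ n ih =>
    rw [relBoundary_succ, relBoundary_succ, map_neg, map_neg, map_neg, neg_neg, relChainAssoc_inv,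
      ih, map_zero]

/-- The map `C_n(A|B, X) → C_n(A|B, Y)` given by a map `X → Y` of `B`-bimodules. -/
def relChainMap (n : ℕ) (h : X →+ Y) (hl : ∀ (b : B) x, h (lact (b : A) x) = lact (b : A) (h x))
    (hr : ∀ x (b : B), h (ract x (b : A)) = ract (h x) (b : A)) :
    relChain B X n →ₗ[k] relChain B Y n :=
  envMapLeft B h hl hr (V := bimodPow (quotBimod B) n)

theorem relChainMap_mk {n : ℕ} (h : X →+ Y)
    (hl : ∀ (b : B) x, h (lact (b : A) x) = lact (b : A) (h x))
    (hr : ∀ x (b : B), h (ract x (b : A)) = ract (h x) (b : A)) (x : X)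
    (α : Fin n → quotBimod B) :
    relChainMap B n h hl hr (relChainMk B x α) = relChainMk B (h x) α := rfl

end Boundary

/-! ### Naturality of the boundary in the coefficients. -/

section Naturality

variable {k : Type u} [Field k] {A : Type u} [Ring A] [Algebra k A] (B : Subalgebra k A)
variable {X Y : ModuleCat.{u} (Env k A)}

/-- Right multiplication on `X` by elements of `A` outside `B` occurs only in the leading term; the
contractions do not touch `x`, and the last term uses the left action. A map that is left `A`-linear
and right `B`-linear thus commutes with the boundary up to its defect in the leading term. Zero
defect gives naturality; the defect of `barShift` gives the contracting homotopy. -/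
theorem relChainMap_relBoundary_sub (σ : LinearSection B) {n : ℕ} (h : X →+ Y)
    (hl : ∀ (a : A) x, h (lact a x) = lact a (h x))
    (hr : ∀ x (b : B), h (ract x (b : A)) = ract (h x) (b : A)) (x : X)
    (α : Fin (n + 1) → quotBimod B) :
    relChainMap B n h (fun b => hl b) hr (relBoundary B n X (relChainMk B x α)) -
      relBoundary B n Y (relChainMk B (h x) α) =
      relChainMk B (h (ract x (σ.toMap (α 0))) - ract (h x) (σ.toMap (α 0))) (Fin.tail α) := by
  have h1 := isRelBoundary_relBoundary B X σ n x α
  have h2 := isRelBoundary_relBoundary B Y σ n (h x) α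
  change relBoundary B n X (relChainMk B x α) = _ at h1
  change relBoundary B n Y (relChainMk B (h x) α) = _ at h2
  rw [h1, h2, map_add, map_add, map_sum, relChainMap_mk, map_zsmul, relChainMap_mk, hl,
    sub_relChainMk, Finset.sum_congr rfl fun i _ => (by rw [map_zsmul, relChainMap_mk])]
  abel

theorem relChainMap_relBoundary {n : ℕ} (h : X →+ Y)
    (hl : ∀ (a : A) x, h (lact a x) = lact a (h x))
    (hr : ∀ x (a : A), h (ract x a) = ract (h x) a) (z : relChain B X (n + 1)) :
    relChainMap B n h (fun b => hl b) (fun x b => hr x b) (relBoundary B n X z) =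
      relBoundary B n Y (relChainMap B (n + 1) h (fun b => hl b) (fun x b => hr x b) z) := by
  refine LinearMap.congr_fun (f := relChainMap B n h (fun b => hl b) (fun x b => hr x b) ∘ₗ
    relBoundary B n X) (g := relBoundary B n Y ∘ₗ
      relChainMap B (n + 1) h (fun b => hl b) (fun x b => hr x b))
    (relChain_hom_ext B fun x α => ?_) z
  rw [← sub_eq_zero]
  refine (relChainMap_relBoundary_sub B (someSection B) h hl (fun x b => hr x b) x α).trans ?_
  rw [hr, sub_self, zero_relChainMk]

end Naturality

/-! ### The regular bimodule `A^e`. -/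

section Regular

variable (k : Type u) [Field k] (A : Type u) [Ring A] [Algebra k A]

/-- `A^e` as an `A`-bimodule, through its right multiplication on itself:
`c (a ⊗ a') d = a d ⊗ c a'`. -/
def envBimod : ModuleCat.{u} (Env k A) :=
  (ModuleCat.restrictScalars (envSwap k A).symm.toAlgHom.toRingHom).obj
    (ModuleCat.of (Env k A)ᵐᵒᵖ (Env k A))

variable {k A}

/-- An element of `A^e` as an element of the bimodule `A^e`. -/
def envMk : Env k A →+ envBimod k A := AddMonoidHom.id (Env k A)

theorem envMk_surjective (x : envBimod k A) : ∃ u, envMk u = x := ⟨x, rfl⟩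

theorem lact_envMk (c : A) (u : Env k A) :
    lact c (envMk u) = envMk (u * ((1 : A) ⊗ₜ[k] op c)) := rfl

theorem ract_envMk (u : Env k A) (c : A) :
    ract (envMk u) c = envMk (u * (c ⊗ₜ[k] (1 : Aᵐᵒᵖ))) := rfl

theorem smul_envMk (c : k) (u : Env k A) :
    c • envMk u = envMk (algebraMap k (Env k A) c * u) := by
  rw [← ract_algebraMap, ract_envMk, ← algebraMap_env, Algebra.commutes]

/-- The action of the elements of the bimodule `A^e` on an `A^e`-module. -/
def envSMul (M : ModuleCat.{u} (Env k A)) : envBimod k A →+ M →+ M := smulAddHom (Env k A) M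

theorem envSMul_envMk {M : ModuleCat.{u} (Env k A)} (u : Env k A) (m : M) :
    envSMul M (envMk u) m = u • m := rfl

/-- Left multiplication by `w` on the bimodule `A^e`. -/
def envMulLeft (w : Env k A) : envBimod k A →+ envBimod k A :=
  AddMonoidHom.mulLeft (R := Env k A) w

theorem envMulLeft_envMk (w u : Env k A) : envMulLeft w (envMk u) = envMk (w * u) := rfl

theorem envMulLeft_lact (w : Env k A) (c : A) (x : envBimod k A) :
    envMulLeft w (lact c x) = lact c (envMulLeft w x) := by
  obtain ⟨u, rfl⟩ := envMk_surjective x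
  rw [lact_envMk, envMulLeft_envMk, envMulLeft_envMk, lact_envMk, mul_assoc]

theorem envMulLeft_ract (w : Env k A) (x : envBimod k A) (c : A) :
    envMulLeft w (ract x c) = ract (envMulLeft w x) c := by
  obtain ⟨u, rfl⟩ := envMk_surjective x
  rw [ract_envMk, envMulLeft_envMk, envMulLeft_envMk, ract_envMk, mul_assoc]

theorem envBimod_induction {p : envBimod k A → Prop} (zero : p 0)
    (tmul : ∀ (a a' : A), p (envMk (a ⊗ₜ[k] op a'))) (add : ∀ x y, p x → p y → p (x + y))
    (x : envBimod k A) : p x := by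
  obtain ⟨u, rfl⟩ := envMk_surjective x
  induction u using TensorProduct.induction_on with
  | zero => exact zero
  | tmul a a' => exact tmul a a'.unop
  | add u v hu hv => exact add _ _ hu hv

end Regular

/-! ### Induced modules `A^e ⊗_{B^e} V` and their relative projectivity. -/

section Induced

variable {k : Type u} [Field k] {A : Type u} [Ring A] [Algebra k A] (B : Subalgebra k A)

/-- Left multiplication by `w` on `A^e ⊗_{B^e} V`. -/
def indSMul (V : ModuleCat.{u} (Env k B)) (w : Env k A) :
    envTensor B (envBimod k A) V →ₗ[k] envTensor B (envBimod k A) V :=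
  envMapLeft B (envMulLeft w) (fun b => envMulLeft_lact w (b : A))
    (fun x b => envMulLeft_ract w x b)

theorem indSMul_envTmul {V : ModuleCat.{u} (Env k B)} (w u : Env k A) (v : V) :
    indSMul B V w (envTmul B (envMk u) v) = envTmul B (envMk (w * u)) v := rfl

theorem envTensor_envBimod_ext {V : ModuleCat.{u} (Env k B)} {Z : Type*} [AddCommGroup Z]
    [Module k Z] {f g : envTensor B (envBimod k A) V →ₗ[k] Z}
    (h : ∀ u v, f (envTmul B (envMk u) v) = g (envTmul B (envMk u) v)) : f = g :=
  envTensor_ext B fun x v => by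
    obtain ⟨u, rfl⟩ := envMk_surjective x
    exact h u v

/-- The left action of `A^e` on `A^e ⊗_{B^e} V`. -/
def indAct (V : ModuleCat.{u} (Env k B)) :
    Env k A →ₐ[k] Module.End k (envTensor B (envBimod k A) V) where
  toFun := indSMul B V
  map_one' := envTensor_envBimod_ext B fun u v => by
    rw [indSMul_envTmul, one_mul]; rfl
  map_mul' w w' := envTensor_envBimod_ext B fun u v => by
    rw [Module.End.mul_apply, indSMul_envTmul, indSMul_envTmul, indSMul_envTmul, mul_assoc]
  map_zero' := envTensor_envBimod_ext B fun u v => by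
    rw [indSMul_envTmul, zero_mul, map_zero, zero_envTmul, LinearMap.zero_apply]
  map_add' w w' := envTensor_envBimod_ext B fun u v => by
    rw [LinearMap.add_apply, indSMul_envTmul, indSMul_envTmul, indSMul_envTmul, add_mul, map_add,
      add_envTmul]
  commutes' c := envTensor_envBimod_ext B fun u v => by
    rw [indSMul_envTmul, Module.algebraMap_end_apply, ← smul_envTmul, smul_envMk]

/-- The induced `A^e`-module `A^e ⊗_{B^e} V`. -/
def ind (V : ModuleCat.{u} (Env k B)) : ModuleCat.{u} (Env k A) :=
  letI : Module (Env k A) (envTensor B (envBimod k A) V) :=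
    Module.compHom _ (indAct B V).toRingHom
  ModuleCat.of (Env k A) (envTensor B (envBimod k A) V)

variable {B} {V : ModuleCat.{u} (Env k B)}

variable (B) in
/-- The pure tensor `u ⊗ v` in `A^e ⊗_{B^e} V`. -/
def indMk (u : Env k A) (v : V) : ind B V := envTmul B (envMk u) v

theorem smul_indMk (w u : Env k A) (v : V) : w • indMk B u v = indMk B (w * u) v := rfl

theorem lact_indMk (a : A) (u : Env k A) (v : V) :
    lact a (indMk B u v) = indMk B (a ⊗ₜ[k] (1 : Aᵐᵒᵖ) * u) v := rfl

theorem ract_indMk (u : Env k A) (v : V) (a : A) :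
    ract (indMk B u v) a = indMk B ((1 : A) ⊗ₜ[k] op a * u) v := rfl

theorem indMk_lact (u : Env k A) (b : B) (v : V) :
    indMk B u (lact b v) = indMk B (u * ((b : A) ⊗ₜ[k] (1 : Aᵐᵒᵖ))) v :=
  (ract_envTmul B (envMk u) b v).symm

theorem indMk_ract (u : Env k A) (b : B) (v : V) :
    indMk B u (ract v b) = indMk B (u * ((1 : A) ⊗ₜ[k] op (b : A))) v :=
  (lact_envTmul B b (envMk u) v).symm

theorem indMk_add (u : Env k A) (v w : V) : indMk B u (v + w) = indMk B u v + indMk B u w :=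
  envTmul_add B (envMk u) v w

theorem add_indMk (u u' : Env k A) (v : V) : indMk B (u + u') v = indMk B u v + indMk B u' v :=
  add_envTmul B (envMk u) (envMk u') v

theorem ind_induction {p : ind B V → Prop} (zero : p 0)
    (tmul : ∀ a a' v, p (indMk B (a ⊗ₜ[k] op a') v)) (add : ∀ z w, p z → p w → p (z + w))
    (z : ind B V) : p z :=
  envTensor_induction (X := envBimod k A) B zero (fun x v => by
    induction x using envBimod_induction with
    | zero => rw [zero_envTmul]; exact zero
    | tmul a a' => exact tmul a a' v
    | add x y hx hy => rw [add_envTmul]; exact add _ _ hx hy) add z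

theorem ind_addHom_ext {Z : Type*} [AddCommGroup Z] {f g : ind B V →+ Z}
    (h : ∀ a a' v, f (indMk B (a ⊗ₜ[k] op a') v) = g (indMk B (a ⊗ₜ[k] op a') v)) : f = g := by
  ext z
  induction z using ind_induction with
  | zero => rw [map_zero, map_zero]
  | tmul a a' v => exact h a a' v
  | add z w hz hw => rw [map_add, map_add, hz, hw]

/-- The map `A^e ⊗_{B^e} V → M` given by a map `V → M` of `B`-bimodules. -/
def indLift {M : ModuleCat.{u} (Env k A)} (h : V →+ M)
    (hl : ∀ (b : B) v, h (lact b v) = lact (b : A) (h v))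
    (hr : ∀ v (b : B), h (ract v b) = ract (h v) (b : A)) : ind B V ⟶ M :=
  let f : envTensor B (envBimod k A) V →ₗ[k] M :=
    envLift B (biaddHom (fun x v => envSMul M x (h v)) (fun x v w => by rw [map_add, map_add])
        (fun x y v => by rw [map_add, AddMonoidHom.add_apply]))
      (fun c x v => by
        obtain ⟨u, rfl⟩ := envMk_surjective x
        rw [biaddHom_apply, biaddHom_apply, ← algebraMap_lact, hl, envSMul_envMk, envSMul_envMk,
          ← algebraMap_smul (Env k A) c, smul_smul, Algebra.commutes, ← smul_smul]
        rfl)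
      (fun x b v => by
        obtain ⟨u, rfl⟩ := envMk_surjective x
        rw [biaddHom_apply, biaddHom_apply, hl, ract_envMk, envSMul_envMk, envSMul_envMk, mul_smul]
        rfl)
      (fun x b v => by
        obtain ⟨u, rfl⟩ := envMk_surjective x
        rw [biaddHom_apply, biaddHom_apply, hr, lact_envMk, envSMul_envMk, envSMul_envMk, mul_smul]
        rfl)
  have hf (u : Env k A) (v : V) : f (indMk B u v) = u • h v := rfl
  ModuleCat.ofHom (X := ind B V) (Y := M)
    { f.toAddMonoidHom with
      map_smul' := fun w z => by
        let g : ind B V →+ M := f.toAddMonoidHom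
        change g (w • z) = w • g z
        induction z using ind_induction with
        | zero => simp
        | tmul a a' v =>
          exact (hf _ v).trans ((mul_smul w _ _).trans (congrArg (w • ·) (hf _ v).symm))
        | add z z' hz hz' => rw [smul_add, map_add, map_add, smul_add, hz, hz'] }

theorem indLift_indMk {M : ModuleCat.{u} (Env k A)} (h : V →+ M)
    (hl : ∀ (b : B) v, h (lact b v) = lact (b : A) (h v))
    (hr : ∀ v (b : B), h (ract v b) = ract (h v) (b : A)) (u : Env k A) (v : V) :
    indLift h hl hr (indMk B u v) = u • h v := rfl

theorem ind_hom_ext {M : ModuleCat.{u} (Env k A)} {f g : ind B V ⟶ M}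
    (h : ∀ v, f (indMk B 1 v) = g (indMk B 1 v)) : f = g := by
  ext z
  refine DFunLike.congr_fun (f := f.hom.toAddMonoidHom) (g := g.hom.toAddMonoidHom)
    (ind_addHom_ext fun a a' v => ?_) z
  have : indMk B (a ⊗ₜ[k] op a') v = (a ⊗ₜ[k] op a' : Env k A) • indMk B 1 v := by
    rw [smul_indMk, mul_one]
  change f _ = g _
  rw [this]
  exact (map_smul f.hom _ _).trans ((congrArg _ (h v)).trans (map_smul g.hom _ _).symm)

/-- Induced modules are relatively projective. -/
theorem isRelProjective_ind : IsRelProjective (envMap B) (ind B V) := by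
  intro M N g ⟨⟨s, hs⟩⟩ f
  have hs' (y : N) : g (s y) = y := ConcreteCategory.congr_hom hs y
  have sl (b : B) (y : N) : s (lact (X := N) (b : A) y) = lact (X := M) (b : A) (s y) :=
    hom_lact (X := resBimod B N) (Y := resBimod B M) s b y
  have sr (y : N) (b : B) : s (ract (X := N) y (b : A)) = ract (X := M) (s y) (b : A) :=
    hom_ract (X := resBimod B N) (Y := resBimod B M) s y b
  -- Extension of scalars: an `A^e`-map out of `A^e ⊗_{B^e} V` is the same as a `B^e`-map out of
  -- `V`, and there the `B^e`-linear section `s` may be composed with `f`.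
  let h : V →+ M := AddMonoidHom.mk' (fun v => s (f (indMk B 1 v))) fun v w => by
    rw [indMk_add, map_add]
    exact map_add s.hom (f (indMk B 1 v)) (f (indMk B 1 w))
  have hh (v : V) : h v = s (f (indMk B 1 v)) := rfl
  refine ⟨indLift h (fun b v => ?_) (fun v b => ?_), ind_hom_ext fun v => ?_⟩
  · rw [hh, hh, indMk_lact, one_mul, ← mul_one ((b : A) ⊗ₜ[k] (1 : Aᵐᵒᵖ)), ← lact_indMk, hom_lact]
    exact sl _ _
  · rw [hh, hh, indMk_ract, one_mul, ← mul_one ((1 : A) ⊗ₜ[k] op (b : A)), ← ract_indMk, hom_ract]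
    exact sr _ _
  · rw [ConcreteCategory.comp_apply, indLift_indMk, one_smul]
    exact hs' _

end Induced

/-! ### The normalized relative bar resolution as `C_*(A|B, A^e)`. -/

section Bar

variable {k : Type u} [Field k] {A : Type u} [Ring A] [Algebra k A] (B : Subalgebra k A)

/-- The terms `A^e ⊗_{B^e} (A/B)^{⊗_B n}` of the normalized relative bar resolution. -/
abbrev barObj (n : ℕ) : ModuleCat.{u} (Env k A) := ind B (bimodPow (quotBimod B) n)

/-- The differential of the normalized relative bar resolution. -/
def barD (n : ℕ) : barObj B (n + 1) ⟶ barObj B n :=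
  ModuleCat.ofHom (X := barObj B (n + 1)) (Y := barObj B n)
    { (relBoundary B n (envBimod k A)).toAddMonoidHom with
      -- Left multiplication by `w` commutes with the right multiplications defining the bimodule
      -- `A^e`, so `A^e`-linearity is an instance of naturality in the coefficients.
      map_smul' := fun w z =>
        (relChainMap_relBoundary B (envMulLeft w) (envMulLeft_lact w) (envMulLeft_ract w)
          z).symm }

theorem barD_apply (n : ℕ) (z : relChain B (envBimod k A) (n + 1)) :
    barD B n z = relBoundary B n (envBimod k A) z := rfl

theorem barD_comp_barD (n : ℕ) : barD B (n + 1) ≫ barD B n = 0 := by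
  ext z
  exact relBoundary_relBoundary B (X := envBimod k A) n z

/-- The normalized relative bar complex. -/
def barComplex : ChainComplex (ModuleCat.{u} (Env k A)) ℕ :=
  ChainComplex.of (barObj B) (barD B) (barD_comp_barD B)

/-- The inclusion of `B` in `A`, between the underlying groups of the bimodules. -/
def selfIncl : selfBimod k B →+ selfBimod k A := B.val.toRingHom.toAddMonoidHom

theorem selfIncl_selfMk (b : B) : selfIncl B (selfMk b) = selfMk (b : A) := rfl

/-- The augmentation `A^e ⊗_{B^e} B → A`. -/
def barAug : barObj B 0 ⟶ selfBimod k A :=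
  indLift (V := selfBimod k B)
    (selfIncl B)
    (fun b v => by
      obtain ⟨v, rfl⟩ := selfMk_surjective v
      rw [lact_selfMk, selfIncl_selfMk, selfIncl_selfMk, lact_selfMk, MulMemClass.coe_mul])
    (fun v b => by
      obtain ⟨v, rfl⟩ := selfMk_surjective v
      rw [ract_selfMk, selfIncl_selfMk, selfIncl_selfMk, ract_selfMk, MulMemClass.coe_mul])

theorem barAug_relChainMk (u : Env k A) (α : Fin 0 → quotBimod B) :
    barAug B (relChainMk B (envMk u) α) = u • (selfMk 1 : selfBimod k A) :=
  indLift_indMk (V := selfBimod k B) _ _ _ u (selfMk 1)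

/-- The map `a ⊗ a' ↦ (1 ⊗ a') ⊗ π(a)`. -/
def barShift : envBimod k A →+ twist B (envBimod k A) :=
  TensorProduct.liftAddHom (R := k) (M := A) (N := Aᵐᵒᵖ) (P := twist B (envBimod k A))
    (biaddHom (fun a a' => twistMk B (envMk ((1 : A) ⊗ₜ[k] a')) (proj B a))
      (fun a a' a₁' => by rw [TensorProduct.tmul_add, map_add, add_twistMk])
      (fun a a₁ a' => by rw [proj_add, twistMk_add]))
    (fun c a a' => by
      have h : c • proj B a = lact (algebraMap k B c) (proj B a) := rfl
      rw [biaddHom_apply, biaddHom_apply, proj_smul, h, ← ract_twistMk]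
      change twistMk B (ract _ (algebraMap k A c)) _ = _
      rw [ract_algebraMap, smul_envMk, ← Algebra.smul_def, TensorProduct.tmul_smul])

theorem barShift_envMk (a a' : A) :
    barShift B (envMk (a ⊗ₜ[k] op a')) =
      twistMk B (envMk ((1 : A) ⊗ₜ[k] op a')) (proj B a) := rfl

/-- The left action on the bimodule `A^e` changes only the second factor `a'`, while the shift moves
the first. -/
theorem barShift_lact (c : A) (x : envBimod k A) :
    barShift B (lact c x) = lact c (barShift B x) := by
  induction x using envBimod_induction with
  | zero => simp
  | tmul a a' =>
    rw [lact_envMk, Algebra.TensorProduct.tmul_mul_tmul, mul_one, ← op_mul, barShift_envMk,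
      barShift_envMk, lact_twistMk, lact_envMk, Algebra.TensorProduct.tmul_mul_tmul, mul_one,
      ← op_mul]
  | add x y hx hy => rw [lact_add, map_add, map_add, lact_add, hx, hy]

/-- On `a ⊗ a'` both sides contain `(1 ⊗ a') ⊗ π(ac)`, and the correction term of the twisted action
leaves `(a ⊗ a') ⊗ π(c)`. -/
theorem barShift_ract_sub (x : envBimod k A) (c : A) :
    barShift B (ract x c) - ract (barShift B x) c = twistMk B x (proj B c) := by
  induction x using envBimod_induction with
  | zero =>
    have : twistMk B (0 : envBimod k A) (proj B c) = 0 := by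
      simpa using add_twistMk B (0 : envBimod k A) 0 (proj B c)
    simp [this]
  | tmul a a' =>
    rw [ract_envMk, Algebra.TensorProduct.tmul_mul_tmul, mul_one, barShift_envMk,
      barShift_envMk, twistMk_ract, ract_envMk, Algebra.TensorProduct.tmul_mul_tmul, one_mul,
      mul_one, sub_sub_cancel]
  | add x y hx hy => rw [add_ract, map_add, map_add, add_ract, add_twistMk, ← hx, ← hy]; abel

theorem barShift_ract (x : envBimod k A) (b : B) :
    barShift B (ract x (b : A)) = ract (barShift B x) (b : A) := by
  rw [← sub_eq_zero, barShift_ract_sub, proj_coe, twistMk_zero]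

/-- The contracting homotopy of the normalized relative bar resolution, as a linear map. -/
def barHomotopyMap (n : ℕ) :
    relChain B (envBimod k A) n →ₗ[k] relChain B (envBimod k A) (n + 1) :=
  relChainAssocInv B (envBimod k A) n ∘ₗ
    relChainMap B n (barShift B) (fun b => barShift_lact B b) (barShift_ract B)

theorem barHomotopyMap_mk {n : ℕ} (x : envBimod k A) (α : Fin n → quotBimod B) :
    barHomotopyMap B n (relChainMk B x α) =
      relChainAssocInv B (envBimod k A) n (relChainMk B (barShift B x) α) := rfl

/-- The minus sign in the recursion turns `s b + b s` into the commutator of `barShift` with the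
boundary. Its defect in the leading term is `x ⊗ π(σ(α₁))`, which restores the absorbed factor `α₁`
and so gives the identity. -/
theorem barHomotopyMap_boundary (n : ℕ) (z : relChain B (envBimod k A) (n + 1)) :
    barHomotopyMap B n (relBoundary B n (envBimod k A) z) +
      relBoundary B (n + 1) (envBimod k A) (barHomotopyMap B (n + 1) z) = z := by
  refine LinearMap.congr_fun (f := barHomotopyMap B n ∘ₗ relBoundary B n (envBimod k A) +
      relBoundary B (n + 1) (envBimod k A) ∘ₗ barHomotopyMap B (n + 1)) (g := LinearMap.id)
    (relChain_hom_ext B fun x α => ?_) z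
  rw [LinearMap.add_apply, LinearMap.comp_apply, LinearMap.comp_apply, barHomotopyMap_mk,
    relBoundary_succ, relChainAssoc_inv, ← sub_eq_add_neg, barHomotopyMap, LinearMap.comp_apply,
    ← map_sub, relChainMap_relBoundary_sub B (someSection B) (barShift B) (barShift_lact B),
    barShift_ract_sub, relChainAssocInv_mk, (someSection B).proj_toMap, Fin.cons_self_tail]
  rfl

/-- In degree zero the term `(1 ⊗ aa') ⊗ 1` remains; it is the augmentation `aa'` followed by the
unit map. -/
theorem relBoundary_barHomotopyMap_zero (a a' : A) (α : Fin 0 → quotBimod B) :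
    relBoundary B 0 (envBimod k A)
        (barHomotopyMap B 0 (relChainMk B (envMk (a ⊗ₜ[k] op a')) α)) =
      relChainMk B (envMk (a ⊗ₜ[k] op a')) α -
        relChainMk B (envMk ((1 : A) ⊗ₜ[k] op (a * a'))) α := by
  rw [barHomotopyMap_mk, barShift_envMk, relChainAssocInv_mk, relBoundary_zero_mk, ract_envMk,
    lact_envMk, Algebra.TensorProduct.tmul_mul_tmul, Algebra.TensorProduct.tmul_mul_tmul, one_mul,
    one_mul, mul_one, ← op_mul, sub_relChainMk, Subsingleton.elim α Fin.elim0]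

/-- The contracting homotopy of the normalized relative bar resolution, as an additive map. -/
def barHomotopyAddHom (n : ℕ) : barObj B n →+ barObj B (n + 1) :=
  (barHomotopyMap B n).toAddMonoidHom

theorem barHomotopyAddHom_indMk {n : ℕ} (a a' : A) (v : bimodPow (quotBimod B) n) :
    barHomotopyAddHom B n (indMk B (a ⊗ₜ[k] op a') v) =
      indMk (V := bimodTensor (quotBimod B) (bimodPow (quotBimod B) n)) B
        ((1 : A) ⊗ₜ[k] op a') (bimodTmul (proj B a) v) :=
  assocInv_envTmul B (envMk ((1 : A) ⊗ₜ[k] op a')) (proj B a) v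

/-- Linearity holds only over `B`: `π(ba) = b π(a)`, and `b` then crosses `⊗_{B^e}` back into `A^e`.
-/
theorem barHomotopyAddHom_lact {n : ℕ} (b : B) (z : barObj B n) :
    barHomotopyAddHom B n (lact (b : A) z) = lact (b : A) (barHomotopyAddHom B n z) := by
  induction z using ind_induction with
  | zero => rw [lact_zero, map_zero, lact_zero]
  | tmul a a' v =>
    rw [lact_indMk, Algebra.TensorProduct.tmul_mul_tmul, one_mul, barHomotopyAddHom_indMk,
      barHomotopyAddHom_indMk, ← lact_proj, ← lact_bimodTmul, indMk_lact]
    refine Eq.trans ?_ (lact_indMk (V := bimodTensor (quotBimod B) (bimodPow (quotBimod B) n))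
      (b : A) _ _).symm
    rw [Algebra.TensorProduct.tmul_mul_tmul, Algebra.TensorProduct.tmul_mul_tmul, one_mul,
      mul_one, mul_one, one_mul]
  | add z w hz hw => rw [lact_add, map_add, map_add, lact_add, hz, hw]

theorem barHomotopyAddHom_ract {n : ℕ} (z : barObj B n) (b : B) :
    barHomotopyAddHom B n (ract z (b : A)) = ract (barHomotopyAddHom B n z) (b : A) := by
  induction z using ind_induction with
  | zero => rw [zero_ract, map_zero, zero_ract]
  | tmul a a' v =>
    rw [ract_indMk, Algebra.TensorProduct.tmul_mul_tmul, one_mul, ← op_mul,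
      barHomotopyAddHom_indMk, barHomotopyAddHom_indMk]
    refine Eq.trans ?_ (ract_indMk (V := bimodTensor (quotBimod B) (bimodPow (quotBimod B) n))
      _ _ (b : A)).symm
    rw [Algebra.TensorProduct.tmul_mul_tmul, one_mul, ← op_mul]
  | add z w hz hw => rw [add_ract, map_add, map_add, add_ract, hz, hw]

/-- The contracting homotopy of the normalized relative bar resolution in positive degrees. -/
def barHomotopy (n : ℕ) : resBimod B (barObj B n) ⟶ resBimod B (barObj B (n + 1)) :=
  bimodHom (X := resBimod B (barObj B n)) (Y := resBimod B (barObj B (n + 1)))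
    (barHomotopyAddHom B n) (barHomotopyAddHom_lact B) (fun b z => barHomotopyAddHom_ract B z b)

/-- The map `a ↦ (1 ⊗ a) ⊗ 1`. -/
def barUnitAddHom : selfBimod k A →+ barObj B 0 :=
  AddMonoidHom.mk' (fun a : A => indMk (V := selfBimod k B) B ((1 : A) ⊗ₜ[k] op a) (selfMk 1))
    (fun a a' : A => by
      refine Eq.trans ?_ (add_indMk (V := selfBimod k B) _ _ _)
      rw [← TensorProduct.tmul_add, ← MulOpposite.op_add]
      rfl)

theorem barUnitAddHom_selfMk (a : A) : barUnitAddHom B (selfMk a) =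
    indMk (V := selfBimod k B) B ((1 : A) ⊗ₜ[k] op a) (selfMk 1) := rfl

/-- The contracting homotopy of the normalized relative bar resolution in degree `-1`. -/
def barUnit : resBimod B (selfBimod k A) ⟶ resBimod B (barObj B 0) :=
  bimodHom (X := resBimod B (selfBimod k A)) (Y := resBimod B (barObj B 0)) (barUnitAddHom B)
    (fun b (x : selfBimod k A) => by
      obtain ⟨a, rfl⟩ := selfMk_surjective (k := k) (A := A) x
      change barUnitAddHom B (lact (b : A) (selfMk a)) =
        lact (b : A) (barUnitAddHom B (selfMk a))
      rw [lact_selfMk, barUnitAddHom_selfMk, barUnitAddHom_selfMk]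
      refine Eq.trans ?_ (lact_indMk (V := selfBimod k B) (b : A) _ _).symm
      -- Left linearity passes through the middle factor `B`: `b` leaves the second component of
      -- `A^e` as `1 · b`, is rewritten as `b · 1`, and returns to the first component.
      have h1 : ((1 : A) ⊗ₜ[k] op ((b : A) * a) : Env k A) =
          ((1 : A) ⊗ₜ[k] op a) * ((1 : A) ⊗ₜ[k] op (b : A)) := by
        rw [Algebra.TensorProduct.tmul_mul_tmul, one_mul, op_mul]
      have h2 : ((b : A) ⊗ₜ[k] (1 : Aᵐᵒᵖ) : Env k A) * ((1 : A) ⊗ₜ[k] op a) =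
          ((1 : A) ⊗ₜ[k] op a) * ((b : A) ⊗ₜ[k] (1 : Aᵐᵒᵖ)) := by
        rw [Algebra.TensorProduct.tmul_mul_tmul, Algebra.TensorProduct.tmul_mul_tmul, one_mul,
          mul_one, mul_one, one_mul]
      rw [h1, h2, ← indMk_ract, ← indMk_lact, ract_selfMk, lact_selfMk, mul_one, one_mul])
    (fun b (x : selfBimod k A) => by
      obtain ⟨a, rfl⟩ := selfMk_surjective (k := k) (A := A) x
      change barUnitAddHom B (ract (selfMk a) (b : A)) =
        ract (barUnitAddHom B (selfMk a)) (b : A)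
      rw [ract_selfMk, barUnitAddHom_selfMk, barUnitAddHom_selfMk]
      refine Eq.trans ?_ (ract_indMk (V := selfBimod k B) _ _ (b : A)).symm
      rw [Algebra.TensorProduct.tmul_mul_tmul, one_mul, op_mul])

/-- The differential is a difference of right multiplications by `a ⊗ 1` and `1 ⊗ a`, which act
equally on `1 ∈ A` because `a · 1 = 1 · a`. -/
theorem barD_comp_barAug : barD B 0 ≫ barAug B = 0 := by
  ext z
  rw [ConcreteCategory.comp_apply]
  change _ = (0 : selfBimod k A)
  induction z using relChain_induction B (X := envBimod k A) (n := 1) with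
  | zero => exact (congrArg (barAug B) (map_zero (barD B 0).hom)).trans (map_zero (barAug B).hom)
  | mk x α =>
    obtain ⟨u, rfl⟩ := envMk_surjective x
    obtain ⟨a, ha⟩ := proj_surjective B (α 0)
    rw [← Fin.cons_self_tail α, ← ha, barD_apply, relBoundary_zero_mk, ract_envMk, lact_envMk,
      ← map_sub, barAug_relChainMk, sub_smul, mul_smul, mul_smul]
    change u • lact a (selfMk 1 : selfBimod k A) - u • ract (selfMk 1 : selfBimod k A) a = 0
    rw [lact_selfMk, ract_selfMk, one_mul, mul_one, sub_self]
  | add z w hz hw =>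
    exact (congrArg (barAug B) (map_add (barD B 0).hom z w)).trans
      ((map_add (barAug B).hom _ _).trans ((congrArg₂ (· + ·) hz hw).trans (add_zero 0)))

theorem barUnit_comp_barAug (x : selfBimod k A) : barAug B (barUnitAddHom B x) = x := by
  obtain ⟨a, rfl⟩ := selfMk_surjective (k := k) (A := A) x
  refine (barAug_relChainMk B _ Fin.elim0).trans ?_
  change ract (selfMk 1 : selfBimod k A) a = _
  rw [ract_selfMk, one_mul]

theorem barHomotopy_zero (z : barObj B 0) :
    barUnitAddHom B (barAug B z) + barD B 0 (barHomotopyAddHom B 0 z) = z := by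
  let f : barObj B 0 →+ barObj B 0 :=
    (barUnitAddHom B).comp (barAug B).hom.toAddMonoidHom +
      (barD B 0).hom.toAddMonoidHom.comp (barHomotopyAddHom B 0)
  change f z = z
  induction z using relChain_induction B (X := envBimod k A) (n := 0) with
  | zero => exact map_zero f
  | mk x α =>
    induction x using envBimod_induction with
    | zero =>
      rw [zero_relChainMk]
      exact map_zero f
    | tmul a a' =>
      have h1 : barAug B (relChainMk B (envMk (a ⊗ₜ[k] op a')) α) = selfMk (a * a') := by
        rw [barAug_relChainMk, env_smul_eq, ract_selfMk, lact_selfMk, one_mul]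
        rfl
      have h2 := relBoundary_barHomotopyMap_zero B a a' α
      refine (congrArg₂ (fun s t : barObj B 0 => s + t) (congrArg (barUnitAddHom B) h1) h2).trans ?_
      exact add_sub_cancel (relChainMk B (envMk ((1 : A) ⊗ₜ[k] op (a * a'))) α)
        (relChainMk B (envMk (a ⊗ₜ[k] op a')) α)
    | add x y hx hy =>
      rw [add_relChainMk]
      exact (map_add f _ _).trans (congrArg₂ (· + ·) hx hy)
  | add z w hz hw => exact (map_add f z w).trans (congrArg₂ (· + ·) hz hw)

theorem barComplex_d (n : ℕ) : (barComplex B).d (n + 1) n = barD B n :=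
  ChainComplex.of_d (barObj B) (barD B) n

/-- The normalized relative bar resolution of `A`. -/
def barResolution : RelProjResolution (envMap B) (selfBimod k A) where
  complex := barComplex B
  aug := barAug B
  d_aug := by
    rw [barComplex_d]
    exact barD_comp_barAug B
  relProjective n := isRelProjective_ind
  contractible := by
    refine ⟨barUnit B, barHomotopy B, ?_, ?_, fun n => ?_⟩
    · ext x
      exact barUnit_comp_barAug B x
    · rw [barComplex_d]
      ext z
      exact barHomotopy_zero B z
    · rw [barComplex_d, barComplex_d]
      ext z
      exact barHomotopyMap_boundary B n z

end Bar

/-! ### Comparison of relative projective resolutions. -/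

section Comparison

variable {k S R : Type u} [Field k] [Ring S] [Algebra k S] [Ring R] [Algebra k R]
  {φ : S →ₐ[k] R} {Y : ModuleCat.{u} R}

/-- A map from a relatively projective module lifts along `g` if it vanishes under a map `q` such
that `g`, `q` are exact by way of an `S`-linear homotopy. -/
theorem IsRelProjective.exists_lift {P : ModuleCat.{u} R} (hP : IsRelProjective φ P)
    {L M N : ModuleCat.{u} R} (g : L ⟶ M) (q : M ⟶ N) (hgq : g ≫ q = 0)
    (s : (ModuleCat.restrictScalars φ.toRingHom).obj M ⟶
      (ModuleCat.restrictScalars φ.toRingHom).obj L)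
    (hs : ∀ x : M, q x = 0 → g (s x) = x) (f : P ⟶ M) (hf : f ≫ q = 0) :
    ∃ h : P ⟶ L, h ≫ g = f := by
  -- On `ker q` the map `s` is an `S`-linear section of `L → ker q`, so relative projectivity
  -- applies once `M` is replaced by the kernel.
  let K : ModuleCat.{u} R := ModuleCat.of R (LinearMap.ker q.hom)
  let g' : L ⟶ K := ModuleCat.ofHom (g.hom.codRestrict (LinearMap.ker q.hom)
    fun x => ConcreteCategory.congr_hom hgq x)
  let f' : P ⟶ K := ModuleCat.ofHom (f.hom.codRestrict (LinearMap.ker q.hom)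
    fun x => ConcreteCategory.congr_hom hf x)
  let i : K ⟶ M := ModuleCat.ofHom (LinearMap.ker q.hom).subtype
  have hsplit : IsSplitEpi ((ModuleCat.restrictScalars φ.toRingHom).map g') :=
    ⟨⟨(ModuleCat.restrictScalars φ.toRingHom).map i ≫ s, by
      ext x
      exact Subtype.ext (hs _ x.2)⟩⟩
  obtain ⟨h, hh⟩ := hP g' hsplit f'
  refine ⟨h, ?_⟩
  have h1 : g' ≫ i = g := rfl
  have h2 : f' ≫ i = f := rfl
  rw [← h1, ← Category.assoc, hh, h2]

namespace RelProjResolution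

variable (P Q : RelProjResolution φ Y)

theorem exists_lift_aug {M : ModuleCat.{u} R} (hM : IsRelProjective φ M) (f : M ⟶ Y) :
    ∃ h : M ⟶ Q.complex.X 0, h ≫ Q.aug = f := by
  obtain ⟨s₀, s, h₀, h₁, h₂⟩ := Q.contractible
  exact hM Q.aug ⟨⟨s₀, h₀⟩⟩ f

/-- On the kernel of the augmentation the term through `s₀` vanishes, and the homotopy identity says
that `s 0` splits `d 1 0` there. `exists_lift_succ` is the same argument one degree higher. -/
theorem exists_lift_zero {M : ModuleCat.{u} R} (hM : IsRelProjective φ M)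
    (f : M ⟶ Q.complex.X 0) (hf : f ≫ Q.aug = 0) :
    ∃ h : M ⟶ Q.complex.X 1, h ≫ Q.complex.d 1 0 = f := by
  obtain ⟨s₀, s, h₀, h₁, h₂⟩ := Q.contractible
  refine hM.exists_lift (Q.complex.d 1 0) Q.aug Q.d_aug (s 0) (fun x hx => ?_) f hf
  have hz : s₀ (Q.aug x) = 0 := (congrArg s₀ hx).trans (map_zero s₀.hom)
  exact (zero_add _).symm.trans
    ((congrArg (fun y : Q.complex.X 0 => y + Q.complex.d 1 0 (s 0 x)) hz.symm).trans
      (ConcreteCategory.congr_hom h₁ x))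

theorem exists_lift_succ {M : ModuleCat.{u} R} (hM : IsRelProjective φ M) (n : ℕ)
    (f : M ⟶ Q.complex.X (n + 1)) (hf : f ≫ Q.complex.d (n + 1) n = 0) :
    ∃ h : M ⟶ Q.complex.X (n + 2), h ≫ Q.complex.d (n + 2) (n + 1) = f := by
  obtain ⟨s₀, s, h₀, h₁, h₂⟩ := Q.contractible
  refine hM.exists_lift (Q.complex.d (n + 2) (n + 1)) (Q.complex.d (n + 1) n)
    (Q.complex.d_comp_d _ _ _) (s (n + 1)) (fun x hx => ?_) f hf
  have hz : s n (Q.complex.d (n + 1) n x) = 0 := (congrArg (s n) hx).trans (map_zero (s n).hom)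
  exact (zero_add _).symm.trans
    ((congrArg (fun y : Q.complex.X (n + 1) => y + Q.complex.d (n + 2) (n + 1) (s (n + 1) x))
      hz.symm).trans (ConcreteCategory.congr_hom (h₂ n) x))

/-- The identity of `Y` is lifted degree by degree; each composite with the previous lift is a
cycle, so a further lift exists. -/
theorem exists_hom : ∃ f : P.complex ⟶ Q.complex, f.f 0 ≫ Q.aug = P.aug := by
  obtain ⟨f₀, h₀⟩ := Q.exists_lift_aug (P.relProjective 0) P.aug
  obtain ⟨f₁, h₁⟩ := Q.exists_lift_zero (P.relProjective 1) (P.complex.d 1 0 ≫ f₀) (by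
    rw [Category.assoc, h₀, P.d_aug])
  exact ⟨ChainComplex.mkHom _ _ f₀ f₁ h₁ fun n p =>
    have h := Q.exists_lift_succ (P.relProjective (n + 2)) n
      (P.complex.d (n + 2) (n + 1) ≫ p.2.1) (by
        rw [Category.assoc, p.2.2, ← Category.assoc, P.complex.d_comp_d, Limits.zero_comp])
    ⟨h.choose, h.choose_spec⟩, h₀⟩

variable {P Q}

/-- The difference `e` vanishes after augmentation. Inductively `e` minus the part of the homotopy
already built is a cycle, hence lifts through the next differential. -/
theorem nonempty_homotopy (f g : P.complex ⟶ Q.complex) (h : f.f 0 ≫ Q.aug = g.f 0 ≫ Q.aug) :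
    Nonempty (Homotopy f g) := by
  suffices Nonempty (Homotopy (f - g) 0) from this.map (Homotopy.equivSubZero.symm)
  set e := f - g with he
  have h0 : e.f 0 ≫ Q.aug = 0 := by
    rw [he, HomologicalComplex.sub_f_apply, Preadditive.sub_comp, h, sub_self]
  obtain ⟨s₀, hs₀⟩ := Q.exists_lift_zero (P.relProjective 0) (e.f 0) h0
  obtain ⟨s₁, hs₁⟩ := Q.exists_lift_succ (P.relProjective 1) 0
    (e.f 1 - P.complex.d 1 0 ≫ s₀) (by
      rw [Preadditive.sub_comp, Category.assoc, hs₀, e.comm, sub_self])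
  have step (n : ℕ) (a : P.complex.X n ⟶ Q.complex.X (n + 1))
      (a' : P.complex.X (n + 1) ⟶ Q.complex.X (n + 2))
      (ha : e.f (n + 1) = P.complex.d (n + 1) n ≫ a + a' ≫ Q.complex.d (n + 2) (n + 1)) :
      ∃ a'' : P.complex.X (n + 2) ⟶ Q.complex.X (n + 3), a'' ≫ Q.complex.d (n + 3) (n + 2) =
        e.f (n + 2) - P.complex.d (n + 2) (n + 1) ≫ a' :=
    Q.exists_lift_succ (P.relProjective (n + 2)) (n + 1) _ (by
      rw [Preadditive.sub_comp, Category.assoc, e.comm, ha, Preadditive.comp_add,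
        ← Category.assoc, P.complex.d_comp_d, Limits.zero_comp, zero_add, sub_self])
  exact ⟨Homotopy.mkInductive e s₀ hs₀.symm s₁ (by rw [hs₁]; abel) fun n p =>
    have h := step n p.1 p.2.1 p.2.2
    ⟨h.choose, by rw [h.choose_spec]; abel⟩⟩

/-- Any two relative projective resolutions are homotopy equivalent. -/
theorem nonempty_homotopyEquiv (P Q : RelProjResolution φ Y) :
    Nonempty (HomotopyEquiv P.complex Q.complex) := by
  obtain ⟨f, hf⟩ := P.exists_hom Q
  obtain ⟨g, hg⟩ := Q.exists_hom P
  obtain ⟨h₁⟩ := nonempty_homotopy (f ≫ g) (𝟙 P.complex) (by simp [hf, hg])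
  obtain ⟨h₂⟩ := nonempty_homotopy (g ≫ f) (𝟙 Q.complex) (by simp [hf, hg])
  exact ⟨⟨f, g, h₁, h₂⟩⟩

end RelProjResolution

/-- Relative `Tor` does not depend on the relative projective resolution. -/
theorem nonempty_relTor_iso (M : ModuleCat.{u} Rᵐᵒᵖ) (P Q : RelProjResolution φ Y) (n : ℕ) :
    Nonempty (relTor M P n ≅ relTor M Q n) := by
  obtain ⟨e⟩ := P.nonempty_homotopyEquiv Q
  exact ⟨((tensorFunctor k R M).mapHomotopyEquiv e).toHomologyIso n⟩

end Comparison

/-! ### From the bar resolution to `C_*(A|B, X)`. -/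

section Eval

variable {k : Type u} [Field k] {A : Type u} [Ring A] [Algebra k A]
variable {X : ModuleCat.{u} (Env k A)}

/-- The right action of `A^e` on a bimodule. -/
def evalHom (x : toRightEnv X) : envBimod k A →+ X :=
  (smulAddHom (Env k A)ᵐᵒᵖ (toRightEnv X)).flip x |>.comp opAddEquiv.toAddMonoidHom

theorem evalHom_envMk (x : toRightEnv X) (u : Env k A) : evalHom x (envMk u) = op u • x := rfl

theorem evalHom_lact (x : toRightEnv X) (c : A) (y : envBimod k A) :
    evalHom x (lact c y) = lact c (evalHom x y) := by
  obtain ⟨u, rfl⟩ := envMk_surjective y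
  rw [lact_envMk, evalHom_envMk, evalHom_envMk, op_mul, mul_smul]
  rfl

theorem evalHom_ract (x : toRightEnv X) (y : envBimod k A) (c : A) :
    evalHom x (ract y c) = ract (evalHom x y) c := by
  obtain ⟨u, rfl⟩ := envMk_surjective y
  rw [ract_envMk, evalHom_envMk, evalHom_envMk, op_mul, mul_smul]
  rfl

theorem add_evalHom (x x' : toRightEnv X) (y : envBimod k A) :
    evalHom (x + x') y = evalHom x y + evalHom x' y :=
  smul_add (op (show Env k A from y)) x x'

variable (B : Subalgebra k A) {V : ModuleCat.{u} (Env k B)}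

/-- The map `u ⊗ v ↦ x u ⊗ v` from `A^e ⊗_{B^e} V` to `X ⊗_{B^e} V`. -/
def indEval (x : toRightEnv X) : envTensor B (envBimod k A) V →ₗ[k] envTensor B X V :=
  envMapLeft B (evalHom x) (fun b => evalHom_lact x (b : A)) (fun y b => evalHom_ract x y b)

theorem indEval_smul (x : toRightEnv X) (w : Env k A) (z : ind B V) :
    indEval B x (w • z) = indEval B (op w • x) z := by
  refine LinearMap.congr_fun (f := indEval B x ∘ₗ indSMul B V w) (g := indEval B (op w • x))
    (envTensor_envBimod_ext B fun u v => ?_) z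
  rw [LinearMap.comp_apply, indSMul_envTmul]
  refine congrArg (fun y : X => envTmul B y v) ?_
  rw [evalHom_envMk, evalHom_envMk, op_mul, mul_smul]

theorem add_indEval (x x' : toRightEnv X) (z : ind B V) :
    indEval B (x + x') z = indEval B x z + indEval B x' z := by
  refine LinearMap.congr_fun (f := indEval B (x + x')) (g := indEval B x + indEval B x')
    (envTensor_envBimod_ext B fun u v => ?_) z
  refine (congrArg (fun y : X => envTmul B y v) (add_evalHom x x' (envMk u))).trans ?_
  exact add_envTmul B _ _ v

variable (X V) in
/-- The map `X ⊗_{A^e} (A^e ⊗_{B^e} V) → X ⊗_{B^e} V`. -/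
def tensorIndHom : tensorOver k (Env k A) (toRightEnv X) (ind B V) →ₗ[k] envTensor B X V :=
  liftOver (M := toRightEnv X) (N := ind B V)
    (biaddHom (fun x z => indEval B x z) (fun x => map_add (indEval B x)) (add_indEval B))
    (fun c x z =>
      (congrArg (indEval B x) (LinearMap.congr_fun ((indAct B V).commutes c) z)).trans
        ((indEval B x).map_smul c _))
    (fun x r z => (indEval_smul B x r z).symm)

/-- Pure tensors in `X ⊗_{A^e} (A^e ⊗_{B^e} V)`. -/
def tmulInd (x : X) (z : ind B V) : tensorOver k (Env k A) (toRightEnv X) (ind B V) :=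
  tmulOver k (M := toRightEnv X) x z

theorem tmulInd_add (x : X) (z w : ind B V) :
    tmulInd B x (z + w) = tmulInd B x z + tmulInd B x w :=
  tmulOver_add k (M := toRightEnv X) x z w

theorem add_tmulInd (x y : X) (z : ind B V) :
    tmulInd B (x + y) z = tmulInd B x z + tmulInd B y z :=
  add_tmulOver k (M := toRightEnv X) x y z

theorem tmulInd_smul (c : k) (x : X) (z : ind B V) :
    tmulInd B x (c • z) = c • tmulInd B x z :=
  tmulOver_algebraMap_smul k (M := toRightEnv X) c x z

theorem ract_tmulInd (x : X) (a : A) (z : ind B V) :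
    tmulInd B (ract x a) z = tmulInd B x (lact a z) :=
  tmulOver_smul k (M := toRightEnv X) x (a ⊗ₜ[k] (1 : Aᵐᵒᵖ)) z

theorem lact_tmulInd (x : X) (a : A) (z : ind B V) :
    tmulInd B (lact a x) z = tmulInd B x (ract z a) :=
  tmulOver_smul k (M := toRightEnv X) x ((1 : A) ⊗ₜ[k] op a) z

theorem tensorIndHom_tmulInd (x : X) (a a' : A) (v : V) :
    tensorIndHom X B V (tmulInd B x (indMk B (a ⊗ₜ[k] op a') v)) =
      envTmul B (ract (lact a' x) a) v := by
  have h : op (a ⊗ₜ[k] op a' : Env k A) • (show toRightEnv X from x) = ract (lact a' x) a := by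
    change (a' ⊗ₜ[k] op a : Env k A) • x = _
    rw [env_smul_eq, lact_ract, unop_op]
  exact congrArg (fun y : X => envTmul B y v) h

variable (X V) in
/-- The map `X ⊗_{B^e} V → X ⊗_{A^e} (A^e ⊗_{B^e} V)`, `x ⊗ v ↦ x ⊗ (1 ⊗ v)`. -/
def tensorIndInv : envTensor B X V →ₗ[k] tensorOver k (Env k A) (toRightEnv X) (ind B V) :=
  envLift B
    (biaddHom (fun x v => tmulInd B x (indMk B 1 v))
      (fun x v w => by rw [indMk_add, tmulInd_add])
      (fun x y v => add_tmulInd B x y _))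
    (fun c x v => by
      rw [biaddHom_apply, biaddHom_apply, ← tmulInd_smul, ← algebraMap_lact, ← algebraMap_lact,
        lact_indMk, mul_one, indMk_lact, one_mul]
      rfl)
    (fun x b v => by
      rw [biaddHom_apply, biaddHom_apply, indMk_lact, one_mul, ract_tmulInd, lact_indMk, mul_one])
    (fun x b v => by
      rw [biaddHom_apply, biaddHom_apply, indMk_ract, one_mul, lact_tmulInd, ract_indMk, mul_one])

theorem tensorIndInv_envTmul (x : X) (v : V) :
    tensorIndInv X B V (envTmul B x v) = tmulInd B x (indMk B 1 v) := rfl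

theorem tensorIndHom_inv (z : envTensor B X V) : tensorIndHom X B V (tensorIndInv X B V z) = z := by
  induction z using envTensor_induction with
  | zero => simp
  | tmul x v =>
    refine (tensorIndHom_tmulInd B x 1 1 v).trans ?_
    rw [one_lact, ract_one]
  | add z w hz hw => rw [map_add, map_add, hz, hw]

theorem tensorIndInv_hom (z : tensorOver k (Env k A) (toRightEnv X) (ind B V)) :
    tensorIndInv X B V (tensorIndHom X B V z) = z := by
  induction z using tensorOver_induction with
  | zero => simp
  | tmul x y =>
    let x' : X := x
    change tensorIndInv X B V (tensorIndHom X B V (tmulInd B x' y)) = tmulInd B x' y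
    induction y using ind_induction with
    | zero =>
      have : tmulInd B x' (0 : ind B V) = 0 := tmulOver_zero k (M := toRightEnv X) x
      rw [this, map_zero, map_zero]
    | tmul a a' v =>
      rw [tensorIndHom_tmulInd, tensorIndInv_envTmul, ract_tmulInd, lact_tmulInd, lact_indMk,
        ract_indMk, mul_one, Algebra.TensorProduct.tmul_mul_tmul, one_mul, mul_one]
    | add z w hz hw => rw [tmulInd_add, map_add, map_add, hz, hw]
  | add z w hz hw => rw [map_add, map_add, hz, hw]

variable (X V) in
/-- The isomorphism `X ⊗_{A^e} (A^e ⊗_{B^e} V) ≅ X ⊗_{B^e} V`. -/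
def tensorIndIso : tensorOver k (Env k A) (toRightEnv X) (ind B V) ≅ envTensor B X V :=
  LinearEquiv.toModuleIso (LinearEquiv.ofLinearMap (tensorIndHom X B V) (tensorIndInv X B V)
    (LinearMap.ext (tensorIndHom_inv B)) (LinearMap.ext (tensorIndInv_hom B)))

/-- For fixed `x` the isomorphism is induced by the bimodule map `A^e → X`, `u ↦ x u`, so
compatibility with the boundaries is naturality in the coefficients. -/
theorem tensorIndHom_barD (n : ℕ)
    (z : tensorOver k (Env k A) (toRightEnv X) (barObj B (n + 1))) :
    tensorIndHom X B (bimodPow (quotBimod B) n) (mapOver k LinearMap.id (barD B n).hom z) =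
      relBoundary B n X (tensorIndHom X B (bimodPow (quotBimod B) (n + 1)) z) := by
  induction z using tensorOver_induction with
  | zero => rw [map_zero, map_zero, map_zero]; exact (map_zero (relBoundary B n X)).symm
  | tmul x y =>
    rw [mapOver_tmulOver]
    exact relChainMap_relBoundary B (evalHom x) (evalHom_lact x) (evalHom_ract x) y
  | add z w hz hw =>
    rw [map_add, map_add, map_add, hz, hw]
    exact (map_add (relBoundary B n X) _ _).symm

variable (X) in
/-- The complex `(C_*(A|B, X), b_{A|B})`. -/
abbrev relComplex : ChainComplex (ModuleCat.{u} k) ℕ :=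
  ChainComplex.of (relChain B X) (fun n => ModuleCat.ofHom (relBoundary B n X))
    (fun n => by ext z; exact relBoundary_relBoundary B n z)

variable (X) in
/-- The complex `X ⊗_{A^e} N_*` for the normalized relative bar resolution `N_*` is
`(C_*(A|B, X), b_{A|B})`. -/
def tensorBarIso :
    ((tensorFunctor k (Env k A) (toRightEnv X)).mapHomologicalComplex (ComplexShape.down ℕ)).obj
      (barComplex B) ≅ relComplex X B :=
  HomologicalComplex.Hom.isoOfComponents
    (fun n => tensorIndIso X B (bimodPow (quotBimod B) n)) (by
      rintro _ n rfl
      have h : (relComplex X B).d (n + 1) n = ModuleCat.ofHom (relBoundary B n X) :=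
        ChainComplex.of_d (relChain B X) (fun n => ModuleCat.ofHom (relBoundary B n X)) n
      rw [h, Functor.mapHomologicalComplex_obj_d, barComplex_d]
      ext z
      exact (tensorIndHom_barD B n z).symm)

end Eval

end RelHoch

end

/-! ### The main theorem. -/

theorem mainTheorem8 (k : Type u) [Field k] (A : Type u) [Ring A] [Algebra k A]
    (B : Subalgebra k A) (X : ModuleCat.{u} (RelHoch.Env k A)) :
    -- `A` has a relative projective resolution over `B^e ⊆ A^e`
    Nonempty (RelHoch.RelProjResolution (RelHoch.envMap B) (RelHoch.selfBimod k A)) ∧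
    -- `X ⊗_{B^e} B` is `X_B`
    (∃ e : RelHoch.coinvariants B X ≅ RelHoch.relChain B X 0,
      ∀ x : X, e.hom (RelHoch.coinvariantsMk B x) = RelHoch.relChainMk B x Fin.elim0) ∧
    ∃ b : ∀ n, RelHoch.relChain B X (n + 1) ⟶ RelHoch.relChain B X n,
      -- for every section the formula is well defined, and it defines the same maps `b`
      (∀ (σ : RelHoch.LinearSection B)
        (b' : ∀ n, RelHoch.relChain B X (n + 1) ⟶ RelHoch.relChain B X n),
        RelHoch.IsRelBoundary B X σ b' ↔ b' = b) ∧
      -- these maps form a complex, whose homology is the relative Hochschild homology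
      ∃ hb : ∀ n, b (n + 1) ≫ b n = 0,
        ∀ (P : RelHoch.RelProjResolution (RelHoch.envMap B) (RelHoch.selfBimod k A)) (n : ℕ),
          Nonempty (RelHoch.relHH B X P n ≅
            (ChainComplex.of (RelHoch.relChain B X) b hb).homology n) := by
  refine ⟨⟨RelHoch.barResolution B⟩, ⟨RelHoch.coinvariantsIso B X, fun x => rfl⟩,
    fun n => ModuleCat.ofHom (RelHoch.relBoundary B n X), RelHoch.isRelBoundary_iff B,
    fun n => by ext z; exact RelHoch.relBoundary_relBoundary B n z, fun P n => ?_⟩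
  -- An arbitrary resolution is traded for the bar resolution, for which the tensored complex is
  -- `C_*(A|B, X)` itself up to isomorphism.
  obtain ⟨e⟩ := RelHoch.nonempty_relTor_iso (RelHoch.toRightEnv X) P (RelHoch.barResolution B) n
  exact ⟨e ≪≫ (HomologicalComplex.homologyFunctor _ _ n).mapIso (RelHoch.tensorBarIso X B)⟩
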